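/- Let $E$ be an $n$-dimensional real vector space with dual $E^*$, and let $B:E\to E^*$ be a symmetric positive definite linear operator. Put $\|x\|=\langle Bx,x\rangle^{1/2}$ for $x\in E$ and $\|s\|_*=\langle s,B^{-1}s\rangle^{1/2}$ for $s\in E^*$. Let $f:E\to\mathbb R$ be differentiable and bounded below, $f^*=\inf_E f$, and suppose that for some $\nu\in[0,1]$, $L_\nu\ge 0$ $$\|\nabla f(y)-\nabla f(x)\|_*\le L_\nu\|y-x\|^\nu\qquad\text{for all }x,y\in E .$$ Let $\delta\ge 0$ and let $\tilde f(\cdot,\delta):E\to\mathbb R$ be a Borel function with $|f(x)-\tilde f(x,\delta)|\le\delta$ for all $x\in E$. For $\mu>0$ let $$f_\mu(x)=\frac1\kappa\int_E f(x+\mu u)e^{-\|u\|^2/2}\,du,\qquad \kappa=\int_E e^{-\|u\|^2/2}\,du,\qquad g_\mu(x,u,\delta)=\frac{\tilde f(x+\mu u,\delta)-\tilde f(x,\delta)}{\mu}\,Bu .$$ Call $(a_1,a_2)$ an admissible pair if either $$a_1=\frac{L_\nu}{\mu^{1-\nu}}\,n^{\frac{1+\nu}2},\quad a_2=0,$$ or,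 for some $\hat\delta>0$, $$a_1=\Big[\frac1{\hat\delta}\Big]^{\frac{1-\nu}{1+\nu}}\frac{2L_\nu}{\mu^{1-\nu}},\quad a_2=\hat\delta L_\nu\mu^{1+\nu}.$$ Let $(A_1,A_2)$ and $(A_1',A_2')$ be two admissible pairs, chosen independently of each other, with $A_1>0$. Let $D\in(0,1]$, $h=\dfrac{D}{80(n+4)A_1}$, $N\ge1$, $x_0\in E$, and $$x_{k+1}=x_k-hB^{-1}g_\mu(x_k,u_k,\delta),\qquad k=0,\dots,N-1,$$ where $u_0,\dots,u_{N-1}$ are i.i.d. standard Gaussian vectors of the Euclidean space $(E,\|\cdot\|)$, i.e. with density $\kappa^{-1}e^{-\|u\|^2/2}$; let $\mathbb E_{\mathcal U}$ be the expectation over $\mathcal U=(u_0,\dots,u_{N-1})$. Then the integral defining $f_\mu$ converges absolutely at every point, $f_\mu$ is differentiable, the expectations below are finite, and $$\begin{aligned}\min_{0\le k\le N-1}\mathbb E_{\mathcal U}\big[\|\nabla f_\mu(x_k)\|_*^2\big]\le{}&\frac{320(n+4)A_1\,(f_\mu(x_0)-f^*)}{ND}\\&+\frac{D}{4(n+4)}\Big(\frac{4\delta^2}{\mu^2}n+\frac{4L_\nu^2}{(1+\nu)^2}\mu^{2\nu}n^{2+\nu}+\frac{\mu^2(A_1')^2}{4}(n+6)^3+\frac{(A_2')^2}{\mu^2}n\Big)\\&+\frac{320(n+4)A_1}{D}\Big(A_2+\frac{\delta^2}{2A_1\mu^2}n+\frac{\delta^2}{\mu^2}n\Big).\end{aligned}$$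 -/

import Mathlib

open MeasureTheory ProbabilityTheory

noncomputable section

namespace ZerothOrder

/- `E` is a finite-dimensional real vector space; its Mathlib norm is an arbitrary one and only
serves to fix the (unique) vector space topology. The Euclidean structure is given by
`B : E → E*`, a linear bijection which the theorem assumes symmetric and positive definite. -/
variable {E : Type*} [NormedAddCommGroup E] [NormedSpace ℝ E]

/-- The Euclidean norm `‖x‖ = ⟨B x, x⟩ ^ (1/2)` on `E`. -/
def primalNorm (B : E ≃L[ℝ] StrongDual ℝ E) (x : E) : ℝ :=
  Real.sqrt (B x x)

/-- The dual Euclidean norm `‖s‖_* = ⟨s, B⁻¹ s⟩ ^ (1/2)` on `E*`. -/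
def dualNorm (B : E ≃L[ℝ] StrongDual ℝ E) (s : StrongDual ℝ E) : ℝ :=
  Real.sqrt (s (B.symm s))

/-- The unnormalized Gaussian weight `exp (-‖u‖² / 2)`. -/
def gaussWeight (B : E ≃L[ℝ] StrongDual ℝ E) (u : E) : ℝ :=
  Real.exp (-(1 / 2) * primalNorm B u ^ 2)

section Smoothing

variable [FiniteDimensional ℝ E] [MeasurableSpace E] [BorelSpace E]

/-- The normalizing constant `κ = ∫ exp (-‖u‖² / 2) du`. Here `du` is a fixed translation
invariant (Lebesgue) measure on `E`; its scaling cancels wherever `κ` is used below. -/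
def kappa (B : E ≃L[ℝ] StrongDual ℝ E) : ℝ :=
  ∫ u : E, gaussWeight B u ∂Measure.addHaar

/-- The Gaussian approximation `f_μ(x) = κ⁻¹ ∫ f(x + μ u) exp (-‖u‖² / 2) du`. -/
def smoothed (B : E ≃L[ℝ] StrongDual ℝ E) (f : E → ℝ) (μ : ℝ) (x : E) : ℝ :=
  1 / kappa B * ∫ u : E, f (x + μ • u) * gaussWeight B u ∂Measure.addHaar

/-- The law of a standard Gaussian vector of the Euclidean space `(E, B)`: the measure with
density `κ⁻¹ exp (-‖u‖² / 2)`. -/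
def stdGaussianLaw (B : E ≃L[ℝ] StrongDual ℝ E) : Measure E :=
  Measure.addHaar.withDensity fun u => ENNReal.ofReal (1 / kappa B * gaussWeight B u)

end Smoothing

/-- The random gradient estimate `g_μ(x, u, δ) = (f̃(x + μ u, δ) - f̃(x, δ)) / μ · B u ∈ E*`;
`ftilde` is the function `f̃(·, δ)`. -/
def gradEst (B : E ≃L[ℝ] StrongDual ℝ E) (ftilde : E → ℝ) (μ : ℝ) (x u : E) :
    StrongDual ℝ E :=
  ((ftilde (x + μ • u) - ftilde x) / μ) • B u

/-- `(A₁, A₂)` is one of the two admissible pairs of constants in the quadratic-with-slack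
bound for `f_μ`, in dimension `n`, with Hölder data `(ν, L)` and smoothing parameter `μ`. -/
def IsSlackPair (n : ℕ) (ν L μ A₁ A₂ : ℝ) : Prop :=
  (A₁ = L / μ ^ (1 - ν) * (n : ℝ) ^ ((1 + ν) / 2) ∧ A₂ = 0) ∨
  ∃ δhat : ℝ, 0 < δhat ∧
    A₁ = (1 / δhat) ^ ((1 - ν) / (1 + ν)) * (2 * L / μ ^ (1 - ν)) ∧
    A₂ = δhat * L * μ ^ (1 + ν)

end ZerothOrder

end

set_option linter.unusedSectionVars false

/-! The proof is stochastic gradient descent on the smoothing $f_\mu$. A linear isometry onto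
$\mathbb R^n$ turns $B$ into the standard inner product; the step then reads $x\mapsto x-hqu$, with
$q$ the noisy difference quotient along a Gaussian direction $u$. Write $s=\nabla f_\mu(x)$.

Three estimates carry the argument. First, $f_\mu$ differs from its linearization by at most
$\frac{A_1}2\|y-x\|^2+A_2$ (`IsSlackPair.abs_taylor_gaussSmooth_le`): either smoothing makes the
gradient Lipschitz, or Young's inequality trades the Hölder remainder for a quadratic plus a
constant. Second, the exact quotient satisfies $\mathbb E[q\langle s,u\rangle]=\|s\|^2$, because
$\nabla f_\mu$ can be computed by differentiating the Gaussian kernel; noise costs a quarter of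
$\|s\|^2$ plus $4\delta^2n/\mu^2$ (`le_integral_diffQuot_mul_fderiv`). Third, $\mathbb
E[q^2\|u\|^2]\le5((n+2)\|s\|^2+X)$, where $X$ is `residual` (`integral_diffQuot_sq_mul_le`).

The two admissible pairs play separate roles: the unprimed one bounds the descent, the primed one
enters only $X$. The step size makes the second-order term at most $\frac h{32}\|s\|^2$ plus a
multiple of $X$, so one step lowers $f_\mu$ on average by $\frac h4\|s\|^2$ up to a constant error
(`integral_gaussSmooth_step_le`). Independence of $x_k$ and $u_k$ allows averaging over $u_k$ first;
summing over $k$, using $f_\mu\ge f^*$ and bounding the minimum by the mean gives the rate. -/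

namespace ZerothOrder

/-! ### Functions of polynomial growth: a class closed under the operations needed for
integrability. -/

section PolyGrowth

variable {F G : Type*} [NormedAddCommGroup F] [NormedAddCommGroup G]

/-- `g` grows at most polynomially. -/
def PolyGrowth (g : F → G) : Prop :=
  ∃ (C : ℝ) (k : ℕ), 0 ≤ C ∧ ∀ u, ‖g u‖ ≤ C * (1 + ‖u‖) ^ k

lemma PolyGrowth.mono {G' : Type*} [NormedAddCommGroup G'] {g : F → G} {g' : F → G'}
    (hg : PolyGrowth g) (h : ∀ u, ‖g' u‖ ≤ ‖g u‖) : PolyGrowth g' := by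
  obtain ⟨C, k, hC, hk⟩ := hg
  exact ⟨C, k, hC, fun u => (h u).trans (hk u)⟩

lemma PolyGrowth.norm {g : F → G} (hg : PolyGrowth g) : PolyGrowth fun u => ‖g u‖ :=
  hg.mono fun u => by simp

lemma polyGrowth_const (c : G) : PolyGrowth fun _ : F => c :=
  ⟨‖c‖, 0, norm_nonneg _, fun u => by simp⟩

lemma polyGrowth_id : PolyGrowth fun u : F => u :=
  ⟨1, 1, zero_le_one, fun u => by simp⟩

lemma PolyGrowth.add {g g' : F → G} (hg : PolyGrowth g) (hg' : PolyGrowth g') :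
    PolyGrowth fun u => g u + g' u := by
  obtain ⟨C, k, hC, hk⟩ := hg
  obtain ⟨C', k', hC', hk'⟩ := hg'
  refine ⟨C + C', max k k', by positivity, fun u => ?_⟩
  have h1 : (1 : ℝ) ≤ 1 + ‖u‖ := by linarith [norm_nonneg u]
  calc ‖g u + g' u‖ ≤ ‖g u‖ + ‖g' u‖ := norm_add_le _ _
    _ ≤ C * (1 + ‖u‖) ^ k + C' * (1 + ‖u‖) ^ k' := add_le_add (hk u) (hk' u)
    _ ≤ C * (1 + ‖u‖) ^ max k k' + C' * (1 + ‖u‖) ^ max k k' := by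
      gcongr <;> simp
    _ = _ := by ring

lemma PolyGrowth.neg {g : F → G} (hg : PolyGrowth g) : PolyGrowth fun u => - g u :=
  hg.mono fun u => by simp

lemma PolyGrowth.sub {g g' : F → G} (hg : PolyGrowth g) (hg' : PolyGrowth g') :
    PolyGrowth fun u => g u - g' u := by
  simpa [sub_eq_add_neg] using hg.add hg'.neg

lemma PolyGrowth.of_le_mul {G₁ G₂ : Type*} [NormedAddCommGroup G₁] [NormedAddCommGroup G₂]
    {g : F → G} {g₁ : F → G₁} {g₂ : F → G₂}
    (h₁ : PolyGrowth g₁) (h₂ : PolyGrowth g₂) (h : ∀ u, ‖g u‖ ≤ ‖g₁ u‖ * ‖g₂ u‖) :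
    PolyGrowth g := by
  obtain ⟨C, k, hC, hk⟩ := h₁
  obtain ⟨C', k', hC', hk'⟩ := h₂
  refine ⟨C * C', k + k', by positivity, fun u => ?_⟩
  calc ‖g u‖ ≤ ‖g₁ u‖ * ‖g₂ u‖ := h u
    _ ≤ (C * (1 + ‖u‖) ^ k) * (C' * (1 + ‖u‖) ^ k') := by
      gcongr
      · exact hk u
      · exact hk' u
    _ = _ := by ring

lemma PolyGrowth.mul {g g' : F → ℝ} (hg : PolyGrowth g) (hg' : PolyGrowth g') :
    PolyGrowth fun u => g u * g' u :=
  hg.of_le_mul hg' fun u => by simp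

lemma PolyGrowth.pow {g : F → ℝ} (hg : PolyGrowth g) (m : ℕ) :
    PolyGrowth fun u => g u ^ m := by
  induction m with
  | zero => simpa using polyGrowth_const (F := F) (1 : ℝ)
  | succ m ih => simpa [pow_succ] using ih.mul hg

lemma PolyGrowth.smul [NormedSpace ℝ G] {g : F → ℝ} {g' : F → G} (hg : PolyGrowth g)
    (hg' : PolyGrowth g') : PolyGrowth fun u => g u • g' u :=
  hg.of_le_mul hg' fun u => by simp [norm_smul]

lemma PolyGrowth.comp {H : Type*} [NormedAddCommGroup H] {g : F → G} {φ : H → F}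
    (hg : PolyGrowth g) (hφ : PolyGrowth φ) : PolyGrowth fun u => g (φ u) := by
  obtain ⟨C, k, hC, hk⟩ := hg
  have h1 : PolyGrowth fun u => C * (1 + ‖φ u‖) ^ k :=
    (polyGrowth_const C).mul (((polyGrowth_const (1 : ℝ)).add hφ.norm).pow k)
  exact h1.mono fun u => (hk _).trans (le_abs_self _)

lemma PolyGrowth.comp_affine [NormedSpace ℝ F] {g : F → G} (hg : PolyGrowth g) (x : F) (μ : ℝ) :
    PolyGrowth fun u => g (x + μ • u) :=
  hg.comp ((polyGrowth_const x).add ((polyGrowth_const μ).smul polyGrowth_id))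

end PolyGrowth

/-- One term of the exponential series gives $(1+t)^k\le k!\,e^{1+t}$, and $t\le\frac1{4a}+at^2$ by
completing the square. -/
lemma one_add_pow_le_exp (k : ℕ) {a : ℝ} (ha : 0 < a) :
    ∃ C, 0 ≤ C ∧ ∀ t : ℝ, 0 ≤ t → (1 + t) ^ k ≤ C * Real.exp (a * t ^ 2) := by
  refine ⟨k.factorial * Real.exp (1 + 1 / (4 * a)), by positivity, fun t ht => ?_⟩
  have h1 := Real.pow_div_factorial_le_exp (1 + t) (by linarith) k
  rw [div_le_iff₀ (by positivity)] at h1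
  rw [mul_assoc, ← Real.exp_add]
  have h2 : 1 + t ≤ 1 + 1 / (4 * a) + a * t ^ 2 := by
    have : 1 / (4 * a) + a * t ^ 2 - t = (2 * a * t - 1) ^ 2 / (4 * a) := by
      field_simp; ring
    have : 0 ≤ (2 * a * t - 1) ^ 2 / (4 * a) := by positivity
    linarith
  calc (1 + t) ^ k ≤ Real.exp (1 + t) * k.factorial := h1
    _ ≤ Real.exp (1 + 1 / (4 * a) + a * t ^ 2) * k.factorial := by gcongr
    _ = _ := by ring

/-! ### The Gaussian measure built from an arbitrary Haar measure, and integration by parts. -/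

section Gaussian

variable {F : Type*} [NormedAddCommGroup F] [InnerProductSpace ℝ F] [FiniteDimensional ℝ F]
  [MeasurableSpace F] [BorelSpace F] (lam : Measure F) [lam.IsAddHaarMeasure]

lemma integrable_exp_neg_mul_sq_norm {a : ℝ} (ha : 0 < a) :
    Integrable (fun u : F => Real.exp (-a * ‖u‖ ^ 2)) lam := by
  have h1 : Integrable (fun u : F => Real.exp (-a * ‖u‖ ^ 2)) := by
    have := (GaussianFourier.integrable_cexp_neg_mul_sq_norm_add (V := F) (b := a)
      (by simpa using ha) 0 0).norm
    refine this.congr (.of_forall fun u => ?_)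
    simp only [zero_mul, add_zero, Complex.norm_exp]
    congr 1
    norm_cast
  rw [Measure.isAddLeftInvariant_eq_smul lam volume]
  exact h1.smul_measure_nnreal

/-- Half of the Gaussian exponent absorbs the polynomial; the other half remains integrable. -/
lemma PolyGrowth.integrable_mul_exp {G : Type*} [NormedAddCommGroup G] [NormedSpace ℝ G]
    {g : F → G} (hg : PolyGrowth g) (hm : AEStronglyMeasurable g lam) {a : ℝ} (ha : 0 < a) :
    Integrable (fun u => Real.exp (-a * ‖u‖ ^ 2) • g u) lam := by
  obtain ⟨C, k, hC, hk⟩ := hg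
  obtain ⟨C', hC', hk'⟩ := one_add_pow_le_exp k (half_pos ha)
  refine ((integrable_exp_neg_mul_sq_norm lam (half_pos ha)).const_mul (C * C')).mono' ?_
    (.of_forall fun u => ?_)
  · exact (Continuous.aestronglyMeasurable (by fun_prop)).smul hm
  · rw [norm_smul, Real.norm_eq_abs, Real.abs_exp]
    calc Real.exp (-a * ‖u‖ ^ 2) * ‖g u‖
        ≤ Real.exp (-a * ‖u‖ ^ 2) * (C * (C' * Real.exp (a / 2 * ‖u‖ ^ 2))) := by
          gcongr
          exact (hk u).trans (by gcongr; exact hk' _ (norm_nonneg u))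
      _ = C * C' * (Real.exp (-a * ‖u‖ ^ 2) * Real.exp (a / 2 * ‖u‖ ^ 2)) := by ring
      _ = _ := by rw [← Real.exp_add]; congr 2; ring

/-- The standard Gaussian measure of a Euclidean space, normalized from a Haar measure. -/
noncomputable def gaussMeasure : Measure F :=
  lam.withDensity fun u => ENNReal.ofReal
    (1 / (∫ v : F, Real.exp (-(1 / 2) * ‖v‖ ^ 2) ∂lam) * Real.exp (-(1 / 2) * ‖u‖ ^ 2))

lemma gaussNorm_pos : 0 < ∫ v : F, Real.exp (-(1 / 2) * ‖v‖ ^ 2) ∂lam :=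
  integral_exp_pos (integrable_exp_neg_mul_sq_norm lam (by norm_num))

lemma integral_gaussMeasure {G : Type*} [NormedAddCommGroup G] [NormedSpace ℝ G] (g : F → G) :
    ∫ u, g u ∂gaussMeasure lam = (1 / (∫ v : F, Real.exp (-(1 / 2) * ‖v‖ ^ 2) ∂lam)) •
      ∫ u, Real.exp (-(1 / 2) * ‖u‖ ^ 2) • g u ∂lam := by
  have := gaussNorm_pos lam
  rw [gaussMeasure, integral_withDensity_eq_integral_toReal_smul (by fun_prop) (by simp),
    ← integral_smul]
  refine integral_congr_ae (.of_forall fun u => ?_)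
  simp only
  rw [ENNReal.toReal_ofReal (by positivity), mul_smul]

lemma integrable_gaussMeasure_iff {G : Type*} [NormedAddCommGroup G] [NormedSpace ℝ G]
    (g : F → G) :
    Integrable g (gaussMeasure lam) ↔
      Integrable (fun u => Real.exp (-(1 / 2) * ‖u‖ ^ 2) • g u) lam := by
  have := gaussNorm_pos lam
  rw [gaussMeasure, integrable_withDensity_iff_integrable_smul' (by fun_prop) (by simp)]
  refine Iff.trans ?_ (integrable_smul_iff
    (c := 1 / (∫ v : F, Real.exp (-(1 / 2) * ‖v‖ ^ 2) ∂lam)) (by positivity) _)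
  refine integrable_congr (.of_forall fun u => ?_)
  simp only [Pi.smul_apply]
  rw [ENNReal.toReal_ofReal (by positivity), mul_smul]

instance : IsProbabilityMeasure (gaussMeasure lam) := by
  have h := gaussNorm_pos lam
  have hi : Integrable (fun u : F => 1 / (∫ v : F, Real.exp (-(1 / 2) * ‖v‖ ^ 2) ∂lam) *
      Real.exp (-(1 / 2) * ‖u‖ ^ 2)) lam :=
    (integrable_exp_neg_mul_sq_norm lam (by norm_num)).const_mul _
  refine ⟨?_⟩
  rw [gaussMeasure, withDensity_apply _ .univ, Measure.restrict_univ,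
    ← ofReal_integral_eq_lintegral_ofReal hi (.of_forall fun u => by positivity),
    integral_const_mul, one_div, inv_mul_cancel₀ h.ne']
  simp

lemma PolyGrowth.integrable {G : Type*} [NormedAddCommGroup G] [NormedSpace ℝ G]
    {g : F → G} (hg : PolyGrowth g) (hm : AEStronglyMeasurable g lam) :
    Integrable g (gaussMeasure lam) :=
  (integrable_gaussMeasure_iff lam g).2 (hg.integrable_mul_exp lam hm (by norm_num))

lemma hasFDerivAt_gaussExp (u : F) :
    HasFDerivAt (fun u : F => Real.exp (-(1 / 2) * ‖u‖ ^ 2))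
      (-Real.exp (-(1 / 2) * ‖u‖ ^ 2) • innerSL ℝ u) u := by
  have h1 := ((hasStrictFDerivAt_norm_sq u).hasFDerivAt.const_mul (-(1 / 2) : ℝ)).exp
  refine h1.congr_fderiv ?_
  ext d
  simp

/-- Gaussian integration by parts. -/
lemma integral_fderiv_gaussMeasure {g : F → ℝ} (hd : Differentiable ℝ g) (hg : PolyGrowth g)
    (hg' : PolyGrowth (fderiv ℝ g)) (d : F) :
    ∫ u, fderiv ℝ g u d ∂gaussMeasure lam = ∫ u, g u * inner ℝ u d ∂gaussMeasure lam := by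
  have hgd : PolyGrowth fun u => fderiv ℝ g u d :=
    hg'.of_le_mul (polyGrowth_const d) fun u => ContinuousLinearMap.le_opNorm _ _
  have hin : PolyGrowth fun u : F => inner ℝ u d :=
    polyGrowth_id.of_le_mul (polyGrowth_const d) fun u => norm_inner_le_norm _ _
  have hfd : ∀ u : F, fderiv ℝ (fun u : F => Real.exp (-(1 / 2) * ‖u‖ ^ 2)) u d =
      - (Real.exp (-(1 / 2) * ‖u‖ ^ 2) * inner ℝ u d) := fun u => by
    rw [(hasFDerivAt_gaussExp u).fderiv]; simp
  have hgm : AEStronglyMeasurable g lam := hd.continuous.aestronglyMeasurable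
  have key := integral_mul_fderiv_eq_neg_fderiv_mul_of_integrable (μ := lam)
    (f := fun u : F => Real.exp (-(1 / 2) * ‖u‖ ^ 2)) (g := g) (v := d) ?_ ?_ ?_
    (fun u _ => (hasFDerivAt_gaussExp u).differentiableAt) (fun u _ => hd u)
  · rw [integral_gaussMeasure, integral_gaussMeasure]
    congr 1
    simp only [smul_eq_mul]
    rw [key, ← integral_neg]
    refine integral_congr_ae (.of_forall fun u => ?_)
    simp only [hfd]
    ring
  · have := ((hg.mul hin).integrable_mul_exp lam (a := 1 / 2)
      (hgm.mul (by fun_prop)) (by norm_num)).neg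
    refine this.congr (.of_forall fun u => ?_)
    simp only [hfd, Pi.neg_apply, smul_eq_mul]
    ring
  · exact hgd.integrable_mul_exp lam (measurable_fderiv_apply_const ℝ g d).aestronglyMeasurable
      (by norm_num)
  · exact hg.integrable_mul_exp lam hgm (by norm_num)

lemma integral_hasFDerivAt_gaussMeasure {g : F → ℝ} {g' : F → F →L[ℝ] ℝ}
    (hd : ∀ u, HasFDerivAt g (g' u) u) (hg : PolyGrowth g) (hg' : PolyGrowth g') (d : F) :
    ∫ u, g' u d ∂gaussMeasure lam = ∫ u, g u * inner ℝ u d ∂gaussMeasure lam := by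
  have h : fderiv ℝ g = g' := funext fun u => (hd u).fderiv
  rw [← h] at hg' ⊢
  exact integral_fderiv_gaussMeasure lam (fun u => (hd u).differentiableAt) hg hg' d

end Gaussian

/-! ### Gaussian moments, and differentiation of Gaussian convolutions. -/

section Moments

variable {F : Type*} [NormedAddCommGroup F] [InnerProductSpace ℝ F] [FiniteDimensional ℝ F]
  [MeasurableSpace F] [BorelSpace F] (lam : Measure F) [lam.IsAddHaarMeasure]

lemma polyGrowth_inner_right (d : F) : PolyGrowth fun u : F => inner ℝ u d :=
  polyGrowth_id.of_le_mul (polyGrowth_const d) fun _ => norm_inner_le_norm _ _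

lemma polyGrowth_norm : PolyGrowth fun u : F => ‖u‖ := polyGrowth_id.norm

lemma polyGrowth_norm_pow (m : ℕ) : PolyGrowth fun u : F => ‖u‖ ^ m := polyGrowth_norm.pow m

lemma integrable_norm_pow_gaussMeasure (m : ℕ) :
    Integrable (fun u : F => ‖u‖ ^ m) (gaussMeasure lam) :=
  (polyGrowth_norm_pow m).integrable lam (by fun_prop)

lemma integral_inner_gaussMeasure (d : F) : ∫ u, inner ℝ u d ∂gaussMeasure lam = 0 := by
  have := integral_hasFDerivAt_gaussMeasure lam (g := fun _ => 1) (g' := fun _ => 0)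
    (fun u => hasFDerivAt_const _ _) (polyGrowth_const _) (polyGrowth_const _) d
  simpa using this.symm

/-- Integration by parts for $\|u\|^{2k}\langle u,v\rangle$ in direction $d$. This single recursion
yields every even moment used below. At $k=0$ the truncated exponent $k-1$ is harmless, since its
coefficient vanishes. -/
lemma integral_norm_pow_mul_inner_mul_inner (k : ℕ) (v d : F) :
    ∫ u, (‖u‖ ^ 2) ^ k * inner ℝ u v * inner ℝ u d ∂gaussMeasure lam =
      (∫ u, (‖u‖ ^ 2) ^ k ∂gaussMeasure lam) * inner ℝ d v +
      2 * k * ∫ u, (‖u‖ ^ 2) ^ (k - 1) * inner ℝ u v * inner ℝ u d ∂gaussMeasure lam := by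
  have hd : ∀ u : F, HasFDerivAt (fun u : F => (‖u‖ ^ 2) ^ k * inner ℝ u v)
      ((‖u‖ ^ 2) ^ k • innerSL ℝ v +
        (inner ℝ u v * (2 * k * (‖u‖ ^ 2) ^ (k - 1))) • innerSL ℝ u) u := fun u => by
    have h1 : HasFDerivAt (fun u : F => (‖u‖ ^ 2) ^ k)
        ((k * (‖u‖ ^ 2) ^ (k - 1)) • (2 • innerSL ℝ u)) u := by
      simpa using (hasStrictFDerivAt_norm_sq u).hasFDerivAt.pow k
    have h2 : HasFDerivAt (fun u : F => inner ℝ u v) (innerSL ℝ v) u := by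
      simpa [real_inner_comm] using (innerSL ℝ v).hasFDerivAt (x := u)
    refine (h1.mul h2).congr_fderiv ?_
    ext w
    simp
    ring
  have hSL : PolyGrowth fun u : F => innerSL ℝ u := polyGrowth_id.mono fun u => by simp
  have h2 : PolyGrowth fun u : F => ‖u‖ ^ 2 := polyGrowth_norm_pow 2
  have hv := polyGrowth_inner_right v
  have hdd := polyGrowth_inner_right d
  rw [← integral_hasFDerivAt_gaussMeasure lam hd ((h2.pow k).mul hv)
    (((h2.pow k).smul (polyGrowth_const _)).add
      ((hv.mul ((polyGrowth_const _).mul (h2.pow _))).smul hSL)) d]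
  simp only [add_apply, smul_apply, innerSL_apply_apply,
    smul_eq_mul]
  rw [integral_add, integral_mul_const, ← integral_const_mul, real_inner_comm]
  · congr 2
    funext u
    ring
  · exact ((h2.pow k).mul (polyGrowth_const _)).integrable lam (by fun_prop)
  · exact ((hv.mul ((polyGrowth_const _).mul (h2.pow _))).mul hdd).integrable lam (by fun_prop)

lemma integral_inner_mul_inner (v d : F) :
    ∫ u, inner ℝ u v * inner ℝ u d ∂gaussMeasure lam = inner ℝ d v := by
  simpa using integral_norm_pow_mul_inner_mul_inner lam 0 v d

/-- The preceding recursion with $v=d=e_i$, summed over an orthonormal basis: the first term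
contributes $n$ and the second $2k$. -/
lemma integral_norm_pow_succ_gaussMeasure (k : ℕ) :
    ∫ u : F, (‖u‖ ^ 2) ^ (k + 1) ∂gaussMeasure lam =
      (Module.finrank ℝ F + 2 * k) * ∫ u : F, (‖u‖ ^ 2) ^ k ∂gaussMeasure lam := by
  set e := stdOrthonormalBasis ℝ F
  have h2 : PolyGrowth fun u : F => ‖u‖ ^ 2 := polyGrowth_norm_pow 2
  have hsum : ∀ u : F, ∑ i, inner ℝ u (e i) * inner ℝ u (e i) = ‖u‖ ^ 2 := fun u => by
    have := e.sum_inner_mul_inner u u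
    rw [real_inner_self_eq_norm_sq] at this
    rw [← this]
    exact Finset.sum_congr rfl fun i _ => by rw [real_inner_comm (e i) u]
  have hS : ∀ j : ℕ, ∑ i, ∫ u, (‖u‖ ^ 2) ^ j * inner ℝ u (e i) * inner ℝ u (e i)
      ∂gaussMeasure lam = ∫ u : F, (‖u‖ ^ 2) ^ (j + 1) ∂gaussMeasure lam := fun j => by
    rw [← integral_finsetSum]
    · refine integral_congr_ae (.of_forall fun u => ?_)
      simp only [mul_assoc]
      rw [← Finset.mul_sum, hsum, pow_succ (‖u‖ ^ 2) j]
    · intro i _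
      exact (((h2.pow j).mul (polyGrowth_inner_right _)).mul
        (polyGrowth_inner_right _)).integrable lam (by fun_prop)
  have hcard : ∑ i, inner ℝ (e i) (e i) = (Module.finrank ℝ F : ℝ) := by
    simp [e.norm_eq_one]
  rw [← hS k]
  simp only [integral_norm_pow_mul_inner_mul_inner lam k]
  rw [Finset.sum_add_distrib, ← Finset.mul_sum, ← Finset.mul_sum, hS, hcard]
  rcases k with _ | k
  · simp
  · simp only [Nat.add_sub_cancel]
    ring

lemma integral_norm_sq_gaussMeasure :
    ∫ u : F, ‖u‖ ^ 2 ∂gaussMeasure lam = Module.finrank ℝ F := by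
  simpa using integral_norm_pow_succ_gaussMeasure lam (F := F) 0

/-- The exact value is $n(n+2)(n+4)$. -/
lemma integral_norm_pow_six_le_gaussMeasure :
    ∫ u : F, ‖u‖ ^ 6 ∂gaussMeasure lam ≤ ((Module.finrank ℝ F : ℝ) + 6) ^ 3 := by
  have h1 := integral_norm_pow_succ_gaussMeasure lam (F := F) 1
  have h2 := integral_norm_pow_succ_gaussMeasure lam (F := F) 2
  have h0 := integral_norm_sq_gaussMeasure lam (F := F)
  norm_num [← pow_mul] at h1 h2
  rw [h0] at h1
  rw [h1] at h2
  rw [h2]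
  have : (0 : ℝ) ≤ Module.finrank ℝ F := by positivity
  nlinarith [mul_nonneg this this]

lemma integral_norm_sq_mul_apply_sq (s : StrongDual ℝ F) :
    ∫ u, ‖u‖ ^ 2 * s u ^ 2 ∂gaussMeasure lam = (Module.finrank ℝ F + 2) * ‖s‖ ^ 2 := by
  obtain ⟨v, rfl⟩ := (InnerProductSpace.toDual ℝ F).surjective s
  have h := integral_norm_pow_mul_inner_mul_inner lam 1 v v
  have h0 := integral_inner_mul_inner lam v v
  simp only [pow_one, Nat.sub_self, pow_zero, one_mul, Nat.cast_one, mul_one, h0,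
    integral_norm_sq_gaussMeasure, real_inner_self_eq_norm_sq] at h
  simp only [LinearIsometryEquiv.norm_map, InnerProductSpace.toDual_apply_apply]
  rw [show ((Module.finrank ℝ F : ℝ) + 2) * ‖v‖ ^ 2 =
    Module.finrank ℝ F * ‖v‖ ^ 2 + 2 * ‖v‖ ^ 2 by ring, ← h]
  refine integral_congr_ae (.of_forall fun u => ?_)
  simp only [real_inner_comm u v]
  ring

/-- Jensen's inequality for the moments of order at most two. -/
lemma integral_norm_rpow_le_gaussMeasure {q : ℝ} (hq0 : 0 < q) (hq2 : q ≤ 2) :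
    Integrable (fun u : F => ‖u‖ ^ q) (gaussMeasure lam) ∧
    ∫ u : F, ‖u‖ ^ q ∂gaussMeasure lam ≤ (Module.finrank ℝ F : ℝ) ^ (q / 2) := by
  have hint : Integrable (fun u : F => ‖u‖ ^ q) (gaussMeasure lam) := by
    refine PolyGrowth.integrable lam ⟨1, 2, zero_le_one, fun u => ?_⟩ ?_
    · rw [Real.norm_eq_abs, abs_of_nonneg (by positivity), one_mul, ← Real.rpow_natCast]
      calc ‖u‖ ^ q ≤ (1 + ‖u‖) ^ q := by gcongr; linarith
        _ ≤ _ := Real.rpow_le_rpow_of_exponent_le (by linarith [norm_nonneg u]) (by simpa)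
    · exact (measurable_norm.pow_const q).aestronglyMeasurable
  refine ⟨hint, ?_⟩
  rcases (Nat.zero_le (Module.finrank ℝ F)).eq_or_lt with h0 | hpos
  · have : Subsingleton F := Module.finrank_zero_iff.1 h0.symm
    have hz : ∀ u : F, ‖u‖ ^ q = 0 := fun u => by
      rw [Subsingleton.elim u 0, norm_zero, Real.zero_rpow hq0.ne']
    simp only [hz, integral_zero]
    positivity
  · set n : ℝ := (Module.finrank ℝ F : ℝ) with hn
    have hn0 : 0 < n := Nat.cast_pos.2 hpos
    -- Tangent line of the concave map $z\mapsto z^{q/2}$ at $z=n$, the mean of $\|u\|^2$; its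
    -- linear part integrates to zero.
    have hle : ∀ u : F, ‖u‖ ^ q ≤ n ^ (q / 2) * (1 + q / 2 * (‖u‖ ^ 2 / n - 1)) := fun u => by
      have h1 := rpow_one_add_le_one_add_mul_self (s := ‖u‖ ^ 2 / n - 1)
        (by linarith [show 0 ≤ ‖u‖ ^ 2 / n by positivity]) (p := q / 2)
        (by positivity) (by linarith)
      have h2 : ‖u‖ ^ q = (‖u‖ ^ 2) ^ (q / 2) := by
        rw [← Real.rpow_natCast, ← Real.rpow_mul (norm_nonneg u)]
        congr 1
        push_cast
        ring
      rw [add_sub_cancel, Real.div_rpow (by positivity) hn0.le, div_le_iff₀ (by positivity)] at h1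
      rw [h2, mul_comm]
      exact h1
    have hi2 := integrable_norm_pow_gaussMeasure lam (F := F) 2
    have hi : Integrable (fun u : F => ‖u‖ ^ 2 / n - 1) (gaussMeasure lam) :=
      (hi2.div_const n).sub (integrable_const _)
    refine (integral_mono hint (((integrable_const _).add (hi.const_mul _)).const_mul _)
      hle).trans ?_
    rw [integral_const_mul, integral_add' (integrable_const _) (hi.const_mul _),
      integral_const_mul, integral_sub (hi2.div_const n) (integrable_const _),
      integral_div, integral_norm_sq_gaussMeasure, ← hn, div_self hn0.ne']
    simp

/-- Differentiation of a Gaussian convolution through its kernel. -/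
lemma hasDerivAt_integral_comp_affine {Φ : F → ℝ} (hm : Measurable Φ) (hΦ : PolyGrowth Φ)
    {μ : ℝ} (hμ : 0 < μ) (x d : F) (t : ℝ) :
    HasDerivAt (fun t : ℝ => ∫ u, Φ (x + t • d + μ • u) ∂gaussMeasure lam)
      (1 / μ * ∫ u, Φ (x + t • d + μ • u) * inner ℝ u d ∂gaussMeasure lam) t := by
  -- A translation of the integration variable moves the parameter from $\Phi$ into the smooth
  -- kernel, so $\Phi$ itself need not be differentiable or even continuous.
  have main : ∀ y : F, HasDerivAt
      (fun r : ℝ => ∫ u, Real.exp (-(1 / 2) * ‖u - r • d‖ ^ 2) * Φ (y + μ • u) ∂lam)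
      (∫ u, Real.exp (-(1 / 2) * ‖u‖ ^ 2) * (Φ (y + μ • u) * inner ℝ u d) ∂lam) 0 := by
    intro y
    have hmy : Measurable fun u => Φ (y + μ • u) := hm.comp (by fun_prop)
    have hd := (hasDerivAt_integral_of_dominated_loc_of_deriv_le (μ := lam) (x₀ := (0 : ℝ))
      (s := Metric.ball 0 1)
      (F := fun r u => Real.exp (-(1 / 2) * ‖u - r • d‖ ^ 2) * Φ (y + μ • u))
      (F' := fun r u => Real.exp (-(1 / 2) * ‖u - r • d‖ ^ 2) * inner ℝ (u - r • d) d *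
        Φ (y + μ • u))
      (bound := fun u => Real.exp (-(1 / 4) * ‖u‖ ^ 2) * (Real.exp (1 / 2 * ‖d‖ ^ 2) *
        ((‖u‖ + ‖d‖) * ‖d‖) * ‖Φ (y + μ • u)‖))
      (Metric.ball_mem_nhds _ one_pos) ?_ ?_ ?_ ?_ ?_ ?_).2
    · refine hd.congr_deriv (integral_congr_ae (.of_forall fun u => ?_))
      simp only [zero_smul, sub_zero]
      ring
    · exact .of_forall fun r => by fun_prop
    · have := (hΦ.comp_affine y μ).integrable_mul_exp lam hmy.aestronglyMeasurable
        (a := 1 / 2) (by norm_num)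
      simpa using this
    · fun_prop
    · refine .of_forall fun u r hr => ?_
      have hr1 : |r| ≤ 1 := by
        rw [mem_ball_zero_iff, Real.norm_eq_abs] at hr
        exact hr.le
      have hrd : ‖r • d‖ ≤ ‖d‖ := by
        rw [norm_smul]; exact mul_le_of_le_one_left (norm_nonneg _) hr1
      rw [norm_mul, norm_mul, Real.norm_eq_abs, Real.abs_exp]
      -- From $\|u\|^2\le2\|u-rd\|^2+2\|d\|^2$ for $|r|\le1$: half of the exponent survives,
      -- uniformly in $r$.
      have h1 : -(1 / 2) * ‖u - r • d‖ ^ 2 ≤ -(1 / 4) * ‖u‖ ^ 2 + 1 / 2 * ‖d‖ ^ 2 := by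
        have h3 : ‖u‖ ≤ ‖u - r • d‖ + ‖d‖ := by
          calc ‖u‖ = ‖(u - r • d) + r • d‖ := by simp
            _ ≤ ‖u - r • d‖ + ‖r • d‖ := norm_add_le _ _
            _ ≤ _ := by gcongr
        have h4 : ‖u‖ ^ 2 ≤ (‖u - r • d‖ + ‖d‖) ^ 2 := by gcongr
        nlinarith [sq_nonneg (‖u - r • d‖ - ‖d‖)]
      have h2 : ‖inner ℝ (u - r • d) d‖ ≤ (‖u‖ + ‖d‖) * ‖d‖ := by
        refine (norm_inner_le_norm _ _).trans ?_
        gcongr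
        exact (norm_sub_le _ _).trans (by gcongr)
      calc _ ≤ Real.exp (-(1 / 4) * ‖u‖ ^ 2 + 1 / 2 * ‖d‖ ^ 2) * ((‖u‖ + ‖d‖) * ‖d‖) *
            ‖Φ (y + μ • u)‖ := by gcongr
        _ = _ := by rw [Real.exp_add]; ring
    · refine PolyGrowth.integrable_mul_exp lam ?_ ?_ (a := 1 / 4) (by norm_num)
      · exact (((polyGrowth_const _).mul ((polyGrowth_norm.add (polyGrowth_const _)).mul
          (polyGrowth_const _))).mul (hΦ.comp_affine y μ).norm)
      · exact Measurable.aestronglyMeasurable (by fun_prop)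
    · refine .of_forall fun u r _ => ?_
      have h1 : HasDerivAt (fun r : ℝ => u - r • d) (-d) r := by
        simpa using ((hasDerivAt_id r).smul_const d).const_sub u
      have h2 := (hasFDerivAt_gaussExp (u - r • d)).comp_hasDerivAt r h1
      refine (h2.mul_const (Φ (y + μ • u))).congr_deriv ?_
      simp only [smul_apply, map_neg, innerSL_apply_apply, smul_eq_mul]
      ring
  set y := x + t • d with hy
  set c : ℝ := 1 / ∫ v : F, Real.exp (-(1 / 2) * ‖v‖ ^ 2) ∂lam with hc
  have hshift : ∀ t' : ℝ, ∫ u, Φ (x + t' • d + μ • u) ∂gaussMeasure lam =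
      c * ∫ u, Real.exp (-(1 / 2) * ‖u - (μ⁻¹ * (t' - t)) • d‖ ^ 2) * Φ (y + μ • u) ∂lam := by
    intro t'
    rw [integral_gaussMeasure, smul_eq_mul, ← hc]
    congr 1
    rw [← integral_sub_right_eq_self _ ((μ⁻¹ * (t' - t)) • d)]
    refine integral_congr_ae (.of_forall fun u => ?_)
    simp only [smul_eq_mul]
    congr 2
    rw [hy, smul_sub, smul_smul, mul_inv_cancel_left₀ hμ.ne', sub_smul]
    abel
  have hin : HasDerivAt (fun t' : ℝ => μ⁻¹ * (t' - t)) μ⁻¹ t := by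
    simpa using ((hasDerivAt_id t).sub_const t).const_mul μ⁻¹
  have hcomp := (HasDerivAt.scomp_of_eq t (main y) hin (by simp)).const_mul c
  have := hcomp.congr_of_eventuallyEq (f₁ := fun t : ℝ => ∫ u, Φ (x + t • d + μ • u)
    ∂gaussMeasure lam) (.of_forall fun t' => by simp [hshift])
  refine this.congr_deriv ?_
  rw [integral_gaussMeasure lam (fun u => Φ (y + μ • u) * inner ℝ u d), ← hc]
  simp only [smul_eq_mul]
  ring

end Moments

/-! ### Hölder gradients: Taylor remainder and growth bounds. -/

section Holder

variable {F : Type*} [NormedAddCommGroup F] [NormedSpace ℝ F]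

/-- `f` is differentiable and its derivative is `ν`-Hölder continuous with constant `L`. -/
structure HasHolderGradient (f : F → ℝ) (ν L : ℝ) : Prop where
  differentiable : Differentiable ℝ f
  norm_fderiv_sub_le : ∀ x y : F, ‖fderiv ℝ f y - fderiv ℝ f x‖ ≤ L * ‖y - x‖ ^ ν
  exponent_nonneg : 0 ≤ ν
  exponent_le_one : ν ≤ 1
  const_nonneg : 0 ≤ L

variable {f : F → ℝ} {ν L : ℝ}

/-- Along the segment the remainder has derivative at most $L\|d\|^{1+\nu}t^\nu$, whose primitive is
the bound at $t=1$. The comparison form of the mean value inequality needs no continuity of the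
gradient, which may fail to follow from the hypothesis when $\nu=0$. -/
lemma HasHolderGradient.taylor (hf : HasHolderGradient f ν L) (x y : F) :
    |f y - f x - fderiv ℝ f x (y - x)| ≤ L / (1 + ν) * ‖y - x‖ ^ (1 + ν) := by
  have hν := hf.exponent_nonneg
  have hL := hf.const_nonneg
  set d := y - x with hd
  have hline : ∀ t : ℝ, HasDerivAt (fun t : ℝ => x + t • d) d t := fun t => by
    simpa using ((hasDerivAt_id t).smul_const d).const_add x
  have hφ : ∀ t : ℝ, HasDerivAt (fun t : ℝ => f (x + t • d) - f x - t * fderiv ℝ f x d)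
      (fderiv ℝ f (x + t • d) d - fderiv ℝ f x d) t := fun t => by
    have h1 := (hf.differentiable (x + t • d)).hasFDerivAt.comp_hasDerivAt t (hline t)
    refine ((h1.sub_const (f x)).sub ((hasDerivAt_id t).mul_const (fderiv ℝ f x d))).congr_deriv ?_
    simp
  have hB : ∀ t : ℝ, HasDerivAt (fun t : ℝ => L / (1 + ν) * ‖d‖ ^ (1 + ν) * t ^ (1 + ν))
      (L * ‖d‖ ^ (1 + ν) * t ^ ν) t := fun t => by
    have h1 := (Real.hasDerivAt_rpow_const (x := t) (p := 1 + ν)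
      (Or.inr (by linarith))).const_mul (L / (1 + ν) * ‖d‖ ^ (1 + ν))
    refine h1.congr_deriv ?_
    rw [add_sub_cancel_left]
    field_simp
  have key := image_norm_le_of_norm_deriv_right_le_deriv_boundary (a := 0) (b := 1)
    (f := fun t : ℝ => f (x + t • d) - f x - t * fderiv ℝ f x d)
    (fun t _ => (hφ t).continuousAt.continuousWithinAt) (fun t _ => (hφ t).hasDerivWithinAt)
    (by simp [Real.zero_rpow (show 1 + ν ≠ 0 by positivity)]) hB ?_
    (show (1 : ℝ) ∈ Set.Icc (0 : ℝ) 1 by simp)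
  · simpa [hd] using key
  · intro t ht
    rw [← sub_apply]
    refine (ContinuousLinearMap.le_opNorm _ _).trans ?_
    calc _ ≤ L * ‖x + t • d - x‖ ^ ν * ‖d‖ := by
          gcongr; exact hf.norm_fderiv_sub_le _ _
      _ = _ := by
          rw [add_sub_cancel_left, norm_smul, Real.norm_eq_abs, abs_of_nonneg ht.1,
            Real.mul_rpow ht.1 (norm_nonneg d), Real.rpow_one_add' (norm_nonneg d) (by positivity)]
          ring

lemma rpow_le_one_add {t p : ℝ} (ht : 0 ≤ t) (hp0 : 0 ≤ p) (hp1 : p ≤ 1) : t ^ p ≤ 1 + t :=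
  calc t ^ p ≤ (1 + t) ^ p := by gcongr; linarith
    _ ≤ (1 + t) ^ (1 : ℝ) := Real.rpow_le_rpow_of_exponent_le (by linarith) hp1
    _ = 1 + t := Real.rpow_one _

lemma HasHolderGradient.norm_fderiv_le (hf : HasHolderGradient f ν L) (z : F) :
    ‖fderiv ℝ f z‖ ≤ ‖fderiv ℝ f 0‖ + L * (1 + ‖z‖) := by
  have h1 := hf.norm_fderiv_sub_le 0 z
  have h2 : ‖z - 0‖ ^ ν ≤ 1 + ‖z‖ := by
    rw [sub_zero]; exact rpow_le_one_add (norm_nonneg z) hf.exponent_nonneg hf.exponent_le_one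
  have h3 := mul_le_mul_of_nonneg_left h2 hf.const_nonneg
  have h4 := norm_sub_norm_le (fderiv ℝ f z) (fderiv ℝ f 0)
  linarith

lemma HasHolderGradient.abs_sub_le (hf : HasHolderGradient f ν L) (x y : F) :
    |f y - f x| ≤ (‖fderiv ℝ f x‖ + L * (1 + ‖y - x‖)) * ‖y - x‖ := by
  have hν := hf.exponent_nonneg
  have h1 := hf.taylor x y
  have h2 : |fderiv ℝ f x (y - x)| ≤ ‖fderiv ℝ f x‖ * ‖y - x‖ := by
    rw [← Real.norm_eq_abs]
    exact ContinuousLinearMap.le_opNorm _ _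
  have h3 : L / (1 + ν) * ‖y - x‖ ^ (1 + ν) ≤ L * (1 + ‖y - x‖) * ‖y - x‖ := by
    rw [Real.rpow_one_add' (norm_nonneg _) (by positivity), mul_comm ‖y - x‖, ← mul_assoc]
    gcongr
    · exact hf.const_nonneg
    · exact div_le_self hf.const_nonneg (by linarith)
    · exact rpow_le_one_add (norm_nonneg _) hν hf.exponent_le_one
  have h4 := abs_add_le (f y - f x - fderiv ℝ f x (y - x)) (fderiv ℝ f x (y - x))
  rw [sub_add_cancel] at h4
  linarith

lemma HasHolderGradient.polyGrowth_fderiv (hf : HasHolderGradient f ν L) :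
    PolyGrowth (fderiv ℝ f) := by
  have h1 : PolyGrowth fun z : F => ‖fderiv ℝ f 0‖ + L * (1 + ‖z‖) :=
    (polyGrowth_const _).add ((polyGrowth_const L).mul
      ((polyGrowth_const (1 : ℝ)).add polyGrowth_id.norm))
  exact h1.mono fun z => (hf.norm_fderiv_le z).trans (le_abs_self _)

lemma HasHolderGradient.polyGrowth (hf : HasHolderGradient f ν L) : PolyGrowth f := by
  have hn : PolyGrowth fun z : F => ‖z‖ := polyGrowth_id.norm
  have h1 : PolyGrowth fun z : F => |f 0| + (‖fderiv ℝ f 0‖ + L * (1 + ‖z‖)) * ‖z‖ :=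
    (polyGrowth_const |f 0|).add (((polyGrowth_const ‖fderiv ℝ f 0‖).add ((polyGrowth_const L).mul
      ((polyGrowth_const (1 : ℝ)).add hn))).mul hn)
  refine h1.mono fun z => ?_
  have h2 := hf.abs_sub_le 0 z
  rw [sub_zero] at h2
  have h3 := abs_sub_abs_le_abs_sub (f z) (f 0)
  rw [Real.norm_eq_abs, Real.norm_eq_abs]
  exact le_trans (by linarith) (le_abs_self _)

end Holder

/-! ### Regularity of the Gaussian smoothing and its distance to the original function. -/

section Smooth

variable {F : Type*} [NormedAddCommGroup F] [InnerProductSpace ℝ F] [FiniteDimensional ℝ F]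
  [MeasurableSpace F] [BorelSpace F] (lam : Measure F) [lam.IsAddHaarMeasure]
  {f : F → ℝ} {ν L μ : ℝ}

/-- The Gaussian smoothing of `f` with parameter `μ`. -/
noncomputable def gaussSmooth (f : F → ℝ) (μ : ℝ) (x : F) : ℝ :=
  ∫ u, f (x + μ • u) ∂gaussMeasure lam

lemma HasHolderGradient.integrable_comp_affine (hf : HasHolderGradient f ν L) (x : F) :
    Integrable (fun u => f (x + μ • u)) (gaussMeasure lam) :=
  (hf.polyGrowth.comp_affine x μ).integrable lam
    (hf.differentiable.continuous.measurable.comp (by fun_prop)).aestronglyMeasurable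

lemma HasHolderGradient.integrable_fderiv_comp_affine (hf : HasHolderGradient f ν L) (x : F) :
    Integrable (fun u => fderiv ℝ f (x + μ • u)) (gaussMeasure lam) :=
  (hf.polyGrowth_fderiv.comp_affine x μ).integrable lam
    ((measurable_fderiv ℝ f).comp (by fun_prop)).aestronglyMeasurable

lemma HasHolderGradient.hasFDerivAt_gaussSmooth (hf : HasHolderGradient f ν L) (hμ : 0 < μ)
    (x : F) : HasFDerivAt (gaussSmooth lam f μ)
      (∫ u, fderiv ℝ f (x + μ • u) ∂gaussMeasure lam) x := by
  refine hasFDerivAt_integral_of_dominated_of_fderiv_le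
    (F := fun x u => f (x + μ • u)) (F' := fun x u => fderiv ℝ f (x + μ • u))
    (bound := fun u => ‖fderiv ℝ f 0‖ + L * (1 + (‖x‖ + 1 + μ * ‖u‖)))
    (Metric.ball_mem_nhds x one_pos) (.of_forall fun y =>
      (hf.integrable_comp_affine lam y).aestronglyMeasurable) (hf.integrable_comp_affine lam x)
    (hf.integrable_fderiv_comp_affine lam x).aestronglyMeasurable
    (.of_forall fun u y hy => ?_) ?_ (.of_forall fun u y _ => ?_)
  · refine (hf.norm_fderiv_le _).trans ?_
    have h1 : ‖y‖ ≤ ‖x‖ + 1 := by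
      rw [mem_ball_iff_norm] at hy
      have := norm_le_insert' y x
      linarith
    have h2 : ‖y + μ • u‖ ≤ ‖x‖ + 1 + μ * ‖u‖ := by
      refine (norm_add_le _ _).trans (add_le_add h1 ?_)
      rw [norm_smul, Real.norm_eq_abs, abs_of_pos hμ]
    have := hf.const_nonneg
    gcongr
  · have h1 := integrable_norm_pow_gaussMeasure lam (F := F) 1
    simp only [pow_one] at h1
    exact (integrable_const _).add (((integrable_const _).add ((integrable_const _).add
      (h1.const_mul μ))).const_mul L)
  · exact (hasFDerivAt_comp_add_right (μ • u)).2 (hf.differentiable (y + μ • u)).hasFDerivAt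

lemma HasHolderGradient.fderiv_gaussSmooth (hf : HasHolderGradient f ν L) (hμ : 0 < μ)
    (x : F) : fderiv ℝ (gaussSmooth lam f μ) x = ∫ u, fderiv ℝ f (x + μ • u) ∂gaussMeasure lam :=
  (hf.hasFDerivAt_gaussSmooth lam hμ x).fderiv

/-- Averaging translates of the gradient preserves its Hölder bound, constant included. -/
lemma HasHolderGradient.gaussSmooth (hf : HasHolderGradient f ν L) (hμ : 0 < μ) :
    HasHolderGradient (gaussSmooth lam f μ) ν L := by
  refine ⟨fun x => (hf.hasFDerivAt_gaussSmooth lam hμ x).differentiableAt, fun x y => ?_,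
    hf.exponent_nonneg, hf.exponent_le_one, hf.const_nonneg⟩
  rw [hf.fderiv_gaussSmooth lam hμ, hf.fderiv_gaussSmooth lam hμ, ← integral_sub
    (hf.integrable_fderiv_comp_affine lam y) (hf.integrable_fderiv_comp_affine lam x)]
  have := norm_integral_le_of_norm_le_const (μ := gaussMeasure lam) (C := L * ‖y - x‖ ^ ν)
    (f := fun u => fderiv ℝ f (y + μ • u) - fderiv ℝ f (x + μ • u)) (.of_forall fun u => by
      simpa using hf.norm_fderiv_sub_le (x + μ • u) (y + μ • u))
  simpa using this

/-- The gradient of the smoothing as a Gaussian average of function values. -/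
lemma HasHolderGradient.fderiv_gaussSmooth_apply (hf : HasHolderGradient f ν L) (hμ : 0 < μ)
    (x d : F) : fderiv ℝ (ZerothOrder.gaussSmooth lam f μ) x d =
      1 / μ * ∫ u, f (x + μ • u) * inner ℝ u d ∂gaussMeasure lam := by
  have h1 := hasDerivAt_integral_comp_affine lam hf.differentiable.continuous.measurable
    hf.polyGrowth hμ x d 0
  have hline : HasDerivAt (fun t : ℝ => x + t • d) d 0 := by
    simpa using ((hasDerivAt_id (0 : ℝ)).smul_const d).const_add x
  have h2 := ((hf.gaussSmooth lam hμ).differentiable x).hasFDerivAt.comp_hasDerivAt_of_eq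
    0 hline (by simp)
  simpa using h2.unique h1

/-- Differentiating the smoothed $\langle\nabla f,e\rangle$ through the kernel gives
$\frac1\mu\mathbb E[\langle\nabla f(z+\mu u),e\rangle\langle u,d\rangle]$. As $\mathbb E u=0$,
$\nabla f(z)$ may be subtracted inside; the Hölder bound then leaves $L\mu^{\nu-1}\,\mathbb
E\|u\|^{1+\nu}$, and the mean value inequality concludes. -/
lemma HasHolderGradient.lipschitz_fderiv_gaussSmooth (hf : HasHolderGradient f ν L) (hμ : 0 < μ) :
    HasHolderGradient (ZerothOrder.gaussSmooth lam f μ) 1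
      (L / μ ^ (1 - ν) * (Module.finrank ℝ F : ℝ) ^ ((1 + ν) / 2)) := by
  have hν := hf.exponent_nonneg
  have hL := hf.const_nonneg
  set C := L / μ ^ (1 - ν) * (Module.finrank ℝ F : ℝ) ^ ((1 + ν) / 2) with hC
  have hC0 : 0 ≤ C := by positivity
  obtain ⟨hqi, hqle⟩ := integral_norm_rpow_le_gaussMeasure lam (F := F) (q := 1 + ν)
    (by linarith) (by linarith [hf.exponent_le_one])
  refine ⟨(hf.gaussSmooth lam hμ).differentiable, fun x y => ?_, zero_le_one, le_rfl, hC0⟩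
  rw [Real.rpow_one]
  refine ContinuousLinearMap.opNorm_le_bound _ (by positivity) fun e => ?_
  set d := y - x with hd
  have happ : ∀ z : F, fderiv ℝ (ZerothOrder.gaussSmooth lam f μ) z e =
      ∫ u, fderiv ℝ f (z + μ • u) e ∂gaussMeasure lam := fun z => by
    rw [hf.fderiv_gaussSmooth lam hμ,
      ContinuousLinearMap.integral_apply (hf.integrable_fderiv_comp_affine lam z)]
  have hm : Measurable fun z => fderiv ℝ f z e := measurable_fderiv_apply_const ℝ f e
  have hg : PolyGrowth fun z => fderiv ℝ f z e :=
    hf.polyGrowth_fderiv.of_le_mul (polyGrowth_const e) fun u => ContinuousLinearMap.le_opNorm _ _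
  have hder := fun t : ℝ => hasDerivAt_integral_comp_affine lam hm hg hμ x d t
  have hbound : ∀ z : F, ‖1 / μ * ∫ u, fderiv ℝ f (z + μ • u) e * inner ℝ u d ∂gaussMeasure lam‖ ≤
      C * ‖d‖ * ‖e‖ := fun z => by
    have hin := (polyGrowth_inner_right d).integrable lam (by fun_prop)
    have hi1 : Integrable (fun u => fderiv ℝ f (z + μ • u) e * inner ℝ u d) (gaussMeasure lam) :=
      ((hg.comp_affine z μ).mul (polyGrowth_inner_right d)).integrable lam
        (((hm.comp (by fun_prop : Measurable fun u : F => z + μ • u)).mul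
          (by fun_prop)).aestronglyMeasurable)
    have h0 : ∫ u, fderiv ℝ f (z + μ • u) e * inner ℝ u d ∂gaussMeasure lam =
        ∫ u, (fderiv ℝ f (z + μ • u) e - fderiv ℝ f z e) * inner ℝ u d ∂gaussMeasure lam := by
      simp only [sub_mul]
      rw [integral_sub hi1 (hin.const_mul _), integral_const_mul, integral_inner_gaussMeasure,
        mul_zero, sub_zero]
    have h1 : ‖∫ u, (fderiv ℝ f (z + μ • u) e - fderiv ℝ f z e) * inner ℝ u d ∂gaussMeasure lam‖ ≤
        ∫ u, L * μ ^ ν * ‖d‖ * ‖e‖ * ‖u‖ ^ (1 + ν) ∂gaussMeasure lam := by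
      refine norm_integral_le_of_norm_le (hqi.const_mul _) (.of_forall fun u => ?_)
      rw [norm_mul, ← sub_apply]
      calc _ ≤ (L * ‖z + μ • u - z‖ ^ ν * ‖e‖) * (‖u‖ * ‖d‖) := by
            gcongr
            · exact (ContinuousLinearMap.le_opNorm _ _).trans
                (by gcongr; exact hf.norm_fderiv_sub_le _ _)
            · exact norm_inner_le_norm _ _
        _ = _ := by
          rw [add_sub_cancel_left, norm_smul, Real.norm_eq_abs, abs_of_pos hμ,
            Real.mul_rpow hμ.le (norm_nonneg u), Real.rpow_one_add' (norm_nonneg u) (by positivity)]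
          ring
    rw [integral_const_mul] at h1
    rw [h0, norm_mul, Real.norm_eq_abs, abs_of_pos (by positivity)]
    calc _ ≤ 1 / μ * (L * μ ^ ν * ‖d‖ * ‖e‖ * (Module.finrank ℝ F : ℝ) ^ ((1 + ν) / 2)) := by
          gcongr
          exact h1.trans (by gcongr)
      _ = C * ‖d‖ * ‖e‖ := by
          rw [hC, Real.rpow_sub hμ, Real.rpow_one]
          field_simp
  have hmv := norm_image_sub_le_of_norm_deriv_le_segment_01'
    (fun t _ => (hder t).hasDerivWithinAt) (fun t _ => hbound (x + t • d))
  simp only [← happ] at hmv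
  rw [sub_apply]
  simpa [hd] using hmv

lemma IsSlackPair.abs_taylor_gaussSmooth_le (hf : HasHolderGradient f ν L) (hμ : 0 < μ)
    {A₁ A₂ : ℝ} (hA : IsSlackPair (Module.finrank ℝ F) ν L μ A₁ A₂) (x y : F) :
    |ZerothOrder.gaussSmooth lam f μ y - ZerothOrder.gaussSmooth lam f μ x -
      fderiv ℝ (ZerothOrder.gaussSmooth lam f μ) x (y - x)| ≤ A₁ / 2 * ‖y - x‖ ^ 2 + A₂ := by
  have hν := hf.exponent_nonneg
  have hν1 := hf.exponent_le_one
  have hL := hf.const_nonneg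
  rcases hA with ⟨rfl, rfl⟩ | ⟨δ, hδ, rfl, rfl⟩
  · have := (hf.lipschitz_fderiv_gaussSmooth lam hμ).taylor x y
    norm_num at this ⊢
    exact this
  · refine ((hf.gaussSmooth lam hμ).taylor x y).trans ?_
    set r := ‖y - x‖ with hr
    have hr0 : 0 ≤ r := norm_nonneg _
    set t := r / μ with ht
    have ht0 : 0 ≤ t := by positivity
    have hrt : r = μ * t := by rw [ht]; field_simp
    -- The power of $1/\hat\delta$ in the first point is chosen so that the factors of $\hat\delta$
    -- cancel in the geometric mean, leaving $t^{1+\nu}$. Both weights are at most one and are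
    -- dropped afterwards.
    have hyoung := Real.geom_mean_le_arith_mean2_weighted (w₁ := (1 + ν) / 2) (w₂ := (1 - ν) / 2)
      (p₁ := t ^ 2 * (1 / δ) ^ ((1 - ν) / (1 + ν))) (p₂ := δ) (by positivity) (by linarith)
      (by positivity) hδ.le (by ring)
    have hlhs : (t ^ 2 * (1 / δ) ^ ((1 - ν) / (1 + ν))) ^ ((1 + ν) / 2) * δ ^ ((1 - ν) / 2) =
        t ^ (1 + ν) := by
      rw [Real.mul_rpow (by positivity) (by positivity), ← Real.rpow_natCast t 2,
        ← Real.rpow_mul ht0, ← Real.rpow_mul (by positivity), mul_assoc, one_div,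
        Real.inv_rpow hδ.le, show (1 - ν) / (1 + ν) * ((1 + ν) / 2) = (1 - ν) / 2 by field_simp,
        inv_mul_cancel₀ (by positivity), mul_one]
      congr 1
      push_cast
      ring
    rw [hlhs] at hyoung
    set a := t ^ 2 * (1 / δ) ^ ((1 - ν) / (1 + ν)) with ha
    have ha0 : 0 ≤ a := by positivity
    have h1 : t ^ (1 + ν) ≤ a + δ := by nlinarith
    have hμν : μ ^ (1 + ν) = μ ^ 2 / μ ^ (1 - ν) := by
      rw [← Real.rpow_natCast μ 2, ← Real.rpow_sub hμ]
      congr 1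
      push_cast
      ring
    calc L / (1 + ν) * r ^ (1 + ν) ≤ L * r ^ (1 + ν) := by
          gcongr; exact div_le_self hL (by linarith)
      _ = L * (μ ^ (1 + ν) * t ^ (1 + ν)) := by rw [hrt, Real.mul_rpow hμ.le ht0]
      _ ≤ L * (μ ^ (1 + ν) * (a + δ)) := by gcongr
      _ = L * (μ ^ (1 + ν) * a) + δ * L * μ ^ (1 + ν) := by ring
      _ = _ := by
        congr 1
        rw [hμν, ha, hrt]
        ring

/-- The linear Taylor term has mean zero, so only the average of the remainder is left. -/
lemma HasHolderGradient.abs_gaussSmooth_sub_le (hf : HasHolderGradient f ν L) (hμ : 0 < μ)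
    (x : F) : |ZerothOrder.gaussSmooth lam f μ x - f x| ≤
      L * μ ^ (1 + ν) / (1 + ν) * (Module.finrank ℝ F : ℝ) ^ ((1 + ν) / 2) := by
  have hν := hf.exponent_nonneg
  have hL := hf.const_nonneg
  obtain ⟨hqi, hqle⟩ := integral_norm_rpow_le_gaussMeasure lam (F := F) (q := 1 + ν)
    (by linarith) (by linarith [hf.exponent_le_one])
  obtain ⟨v, hv⟩ := (InnerProductSpace.toDual ℝ F).surjective (fderiv ℝ f x)
  have hlin : ∀ u : F, fderiv ℝ f x (μ • u) = μ * inner ℝ u v := fun u => by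
    rw [← hv]; simp [real_inner_comm]
  have hin := (polyGrowth_inner_right v).integrable lam (by fun_prop)
  have h0 : ZerothOrder.gaussSmooth lam f μ x - f x =
      ∫ u, (f (x + μ • u) - f x - fderiv ℝ f x (x + μ • u - x)) ∂gaussMeasure lam := by
    simp only [add_sub_cancel_left, hlin]
    have hi : Integrable (fun u => f (x + μ • u) - f x) (gaussMeasure lam) :=
      (hf.integrable_comp_affine lam x).sub (integrable_const _)
    rw [integral_sub hi (hin.const_mul _), integral_sub (hf.integrable_comp_affine lam x) (integrable_const _),
      integral_const_mul, integral_inner_gaussMeasure]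
    simp [ZerothOrder.gaussSmooth]
  rw [h0, ← Real.norm_eq_abs]
  refine (norm_integral_le_of_norm_le (g := fun u => L * μ ^ (1 + ν) / (1 + ν) * ‖u‖ ^ (1 + ν))
    (hqi.const_mul _) (.of_forall fun u => ?_)).trans ?_
  · refine (hf.taylor x (x + μ • u)).trans (le_of_eq ?_)
    rw [add_sub_cancel_left, norm_smul, Real.norm_eq_abs, abs_of_pos hμ,
      Real.mul_rpow hμ.le (norm_nonneg u)]
    ring
  · rw [integral_const_mul]
    gcongr

lemma le_gaussSmooth (hf : HasHolderGradient f ν L) {c : ℝ} (hc : ∀ x, c ≤ f x) (x : F) :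
    c ≤ gaussSmooth lam f μ x := by
  have := integral_mono (μ := gaussMeasure lam) (integrable_const c)
    (hf.integrable_comp_affine lam x (μ := μ)) fun u => hc _
  simpa [gaussSmooth] using this

end Smooth

/-! ### Moments of the gradient estimate and the expected decrease in one step. -/

/-- The finite difference quotient `(f̃(x + μ u) - f̃(x)) / μ`. -/
noncomputable def diffQuot {F : Type*} [AddCommGroup F] [Module ℝ F] (ftilde : F → ℝ) (μ : ℝ)
    (x u : F) : ℝ :=
  (ftilde (x + μ • u) - ftilde x) / μ

/-- The part of the second moment of the gradient estimate not controlled by the gradient of the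
smoothing: noise, smoothing error and linearization error. -/
noncomputable def residual (n : ℕ) (ν L μ δ A₁ A₂ : ℝ) : ℝ :=
  4 * δ ^ 2 / μ ^ 2 * n + 4 * L ^ 2 / (1 + ν) ^ 2 * μ ^ (2 * ν) * (n : ℝ) ^ (2 + ν) +
    μ ^ 2 * A₁ ^ 2 / 4 * ((n : ℝ) + 6) ^ 3 + A₂ ^ 2 / μ ^ 2 * n

lemma residual_nonneg (n : ℕ) {ν L μ δ A₁ A₂ : ℝ} (hμ : 0 < μ) :
    0 ≤ residual n ν L μ δ A₁ A₂ := by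
  unfold residual
  positivity

section OneStep

variable {F : Type*} [NormedAddCommGroup F] [InnerProductSpace ℝ F] [FiniteDimensional ℝ F]
  [MeasurableSpace F] [BorelSpace F] (lam : Measure F) [lam.IsAddHaarMeasure]
  {f ftilde : F → ℝ} {ν L μ δ : ℝ}

lemma polyGrowth_of_abs_sub_le (hf : PolyGrowth f) (hft : ∀ x, |f x - ftilde x| ≤ δ) :
    PolyGrowth ftilde := by
  refine (hf.norm.add (polyGrowth_const δ)).mono fun u => ?_
  have h1 := hft u
  have h2 := abs_sub_abs_le_abs_sub (ftilde u) (f u)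
  rw [abs_sub_comm] at h2
  simp only [Real.norm_eq_abs]
  exact le_trans (by linarith) (le_abs_self _)

lemma polyGrowth_diffQuot (hf : PolyGrowth ftilde) (μ : ℝ) (x : F) :
    PolyGrowth (diffQuot ftilde μ x) := by
  have := ((hf.comp_affine x μ).sub (polyGrowth_const (ftilde x))).mul (polyGrowth_const μ⁻¹)
  exact this.mono fun u => by rw [diffQuot, div_eq_mul_inv]

lemma measurable_diffQuot (hm : Measurable ftilde) (μ : ℝ) (x : F) :
    Measurable (diffQuot ftilde μ x) :=
  ((hm.comp (by fun_prop)).sub_const _).div_const _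

lemma abs_diffQuot_le (hμ : 0 < μ) (hft : ∀ x, |f x - ftilde x| ≤ δ) (x u : F) :
    |diffQuot ftilde μ x u - diffQuot f μ x u| ≤ 2 * δ / μ := by
  rw [diffQuot, diffQuot, ← sub_div, abs_div, abs_of_pos hμ]
  gcongr
  have h1 := abs_le.1 (hft (x + μ • u))
  have h2 := abs_le.1 (hft x)
  rw [abs_le]
  constructor <;> linarith

lemma sq_sum_five_le {c a₁ a₂ a₃ a₄ a₅ : ℝ} (h : |c| ≤ a₁ + a₂ + a₃ + a₄ + a₅) :
    c ^ 2 ≤ 5 * (a₁ ^ 2 + a₂ ^ 2 + a₃ ^ 2 + a₄ ^ 2 + a₅ ^ 2) := by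
  calc c ^ 2 = |c| ^ 2 := (sq_abs c).symm
    _ ≤ (a₁ + a₂ + a₃ + a₄ + a₅) ^ 2 := by gcongr
    _ ≤ _ := by
      nlinarith [sq_nonneg (a₁ - a₂), sq_nonneg (a₁ - a₃), sq_nonneg (a₁ - a₄),
        sq_nonneg (a₁ - a₅), sq_nonneg (a₂ - a₃), sq_nonneg (a₂ - a₄), sq_nonneg (a₂ - a₅),
        sq_nonneg (a₃ - a₄), sq_nonneg (a₃ - a₅), sq_nonneg (a₄ - a₅)]

/-- Replacing $\tilde f$ by $f$ costs $2\delta/\mu$; replacing $f$ by $f_\mu$ at both endpoints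
costs the second term; the rest is the slack Taylor bound for $f_\mu$, divided by $\mu$. -/
lemma abs_diffQuot_le_sum (hf : HasHolderGradient f ν L) (hμ : 0 < μ)
    (hft : ∀ x, |f x - ftilde x| ≤ δ) {A₁ A₂ : ℝ}
    (hA : IsSlackPair (Module.finrank ℝ F) ν L μ A₁ A₂) (x u : F) :
    |diffQuot ftilde μ x u| ≤ 2 * δ / μ +
      2 * (L * μ ^ ν / (1 + ν) * (Module.finrank ℝ F : ℝ) ^ ((1 + ν) / 2)) +
      |fderiv ℝ (gaussSmooth lam f μ) x u| + μ * A₁ / 2 * ‖u‖ ^ 2 + A₂ / μ := by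
  have h1 := abs_diffQuot_le hμ hft x u
  have h2 := abs_le.1 (hf.abs_gaussSmooth_sub_le lam hμ x)
  have h3 := abs_le.1 (hf.abs_gaussSmooth_sub_le lam hμ (x + μ • u))
  have h4 := hA.abs_taylor_gaussSmooth_le lam hf hμ x (x + μ • u)
  set M := L * μ ^ (1 + ν) / (1 + ν) * (Module.finrank ℝ F : ℝ) ^ ((1 + ν) / 2) with hM
  have hM' : M = μ * (L * μ ^ ν / (1 + ν) * (Module.finrank ℝ F : ℝ) ^ ((1 + ν) / 2)) := by
    rw [hM, Real.rpow_add hμ, Real.rpow_one]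
    ring
  rw [add_sub_cancel_left, norm_smul, Real.norm_eq_abs, abs_of_pos hμ, map_smul, smul_eq_mul] at h4
  have h5 : |f (x + μ • u) - f x| ≤ 2 * M + μ * |fderiv ℝ (gaussSmooth lam f μ) x u| +
      (A₁ / 2 * (μ * ‖u‖) ^ 2 + A₂) := by
    have h6 := abs_le.1 h4
    have h7 := mul_le_mul_of_nonneg_left (le_abs_self (fderiv ℝ (gaussSmooth lam f μ) x u)) hμ.le
    have h8 := mul_le_mul_of_nonneg_left (neg_abs_le (fderiv ℝ (gaussSmooth lam f μ) x u)) hμ.le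
    rw [abs_le]
    constructor <;> linarith
  have h6 : |diffQuot f μ x u| ≤
      2 * (L * μ ^ ν / (1 + ν) * (Module.finrank ℝ F : ℝ) ^ ((1 + ν) / 2)) +
      |fderiv ℝ (gaussSmooth lam f μ) x u| + μ * A₁ / 2 * ‖u‖ ^ 2 + A₂ / μ := by
    rw [diffQuot, abs_div, abs_of_pos hμ, div_le_iff₀ hμ]
    refine h5.trans (le_of_eq ?_)
    rw [hM']
    field_simp
    ring
  have h7 := abs_sub_abs_le_abs_sub (diffQuot ftilde μ x u) (diffQuot f μ x u)
  linarith

lemma integrable_diffQuot_sq_mul (hf : HasHolderGradient f ν L) (hm : Measurable ftilde)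
    (hft : ∀ x, |f x - ftilde x| ≤ δ) (x : F) :
    Integrable (fun u => diffQuot ftilde μ x u ^ 2 * ‖u‖ ^ 2) (gaussMeasure lam) :=
  (((polyGrowth_diffQuot (polyGrowth_of_abs_sub_le hf.polyGrowth hft) μ x).pow 2).mul
    (polyGrowth_norm_pow 2)).integrable lam
    (((measurable_diffQuot hm μ x).pow_const 2).mul (by fun_prop)).aestronglyMeasurable

/-- Second moment of the gradient estimate. -/
lemma integral_diffQuot_sq_mul_le (hf : HasHolderGradient f ν L) (hμ : 0 < μ)
    (hm : Measurable ftilde) (hft : ∀ x, |f x - ftilde x| ≤ δ) {A₁ A₂ : ℝ}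
    (hA : IsSlackPair (Module.finrank ℝ F) ν L μ A₁ A₂) (x : F) :
    ∫ u, diffQuot ftilde μ x u ^ 2 * ‖u‖ ^ 2 ∂gaussMeasure lam ≤
      5 * ((Module.finrank ℝ F + 2) * ‖fderiv ℝ (gaussSmooth lam f μ) x‖ ^ 2 +
        residual (Module.finrank ℝ F) ν L μ δ A₁ A₂) := by
  have hν := hf.exponent_nonneg
  set s := fderiv ℝ (gaussSmooth lam f μ) x with hs
  set n : ℝ := (Module.finrank ℝ F : ℝ) with hn
  set M := L * μ ^ ν / (1 + ν) * n ^ ((1 + ν) / 2) with hM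
  have hpt : ∀ u : F, diffQuot ftilde μ x u ^ 2 * ‖u‖ ^ 2 ≤
      5 * (((2 * δ / μ) ^ 2 + (2 * M) ^ 2 + (A₂ / μ) ^ 2) * ‖u‖ ^ 2 + ‖u‖ ^ 2 * s u ^ 2 +
        (μ * A₁ / 2) ^ 2 * ‖u‖ ^ 6) := fun u => by
    have h1 := sq_sum_five_le (abs_diffQuot_le_sum lam hf hμ hft hA x u)
    rw [← hs, ← hn, ← hM, sq_abs] at h1
    refine (mul_le_mul_of_nonneg_right h1 (sq_nonneg ‖u‖)).trans (le_of_eq ?_)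
    ring
  have hi2 := integrable_norm_pow_gaussMeasure lam (F := F) 2
  have hi6 := integrable_norm_pow_gaussMeasure lam (F := F) 6
  have his : Integrable (fun u => ‖u‖ ^ 2 * s u ^ 2) (gaussMeasure lam) :=
    ((polyGrowth_norm_pow 2).mul (((polyGrowth_const s).of_le_mul polyGrowth_id
      (fun u => s.le_opNorm u) : PolyGrowth fun u => s u).pow 2)).integrable lam (by fun_prop)
  have hiA : Integrable (fun u : F => ((2 * δ / μ) ^ 2 + (2 * M) ^ 2 + (A₂ / μ) ^ 2) * ‖u‖ ^ 2)
    (gaussMeasure lam) := hi2.const_mul _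
  have hiB : Integrable (fun u : F => (μ * A₁ / 2) ^ 2 * ‖u‖ ^ 6)
    (gaussMeasure lam) := hi6.const_mul _
  have hiC : Integrable (fun u : F => ((2 * δ / μ) ^ 2 + (2 * M) ^ 2 + (A₂ / μ) ^ 2) * ‖u‖ ^ 2 +
    ‖u‖ ^ 2 * s u ^ 2) (gaussMeasure lam) := hiA.add his
  refine (integral_mono (integrable_diffQuot_sq_mul lam hf hm hft x)
    ((hiC.add hiB).const_mul 5) hpt).trans ?_
  rw [integral_const_mul, integral_add' hiC hiB, integral_add hiA his, integral_const_mul,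
    integral_const_mul, integral_norm_sq_gaussMeasure, integral_norm_sq_mul_apply_sq, ← hn]
  have h6 := integral_norm_pow_six_le_gaussMeasure lam (F := F)
  have hM2 : (2 * M) ^ 2 * n = 4 * L ^ 2 / (1 + ν) ^ 2 * μ ^ (2 * ν) * n ^ (2 + ν) := by
    have hn0 : 0 ≤ n := by positivity
    have h1 : (n ^ ((1 + ν) / 2)) ^ 2 * n = n ^ (2 + ν) := by
      rw [← Real.rpow_natCast (n ^ ((1 + ν) / 2)), ← Real.rpow_mul hn0,
        ← Real.rpow_add_one' hn0 (by positivity)]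
      congr 1
      push_cast
      ring
    have h2 : (μ ^ ν) ^ 2 = μ ^ (2 * ν) := by
      rw [← Real.rpow_natCast, ← Real.rpow_mul hμ.le]
      congr 1
      push_cast
      ring
    rw [← h1, ← h2, hM, mul_pow, mul_pow, div_pow]
    ring
  have h7 := mul_le_mul_of_nonneg_left h6 (sq_nonneg (μ * A₁ / 2))
  rw [← hn] at h7
  have h8 : residual (Module.finrank ℝ F) ν L μ δ A₁ A₂ = (2 * δ / μ) ^ 2 * n + (2 * M) ^ 2 * n +
      (μ * A₁ / 2) ^ 2 * (n + 6) ^ 3 + (A₂ / μ) ^ 2 * n := by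
    rw [hM2, residual]
    ring
  rw [h8]
  linarith

/-- Correlation of the gradient estimate with the gradient of the smoothing. -/
lemma le_integral_diffQuot_mul_fderiv (hf : HasHolderGradient f ν L) (hμ : 0 < μ)
    (hm : Measurable ftilde) (hft : ∀ x, |f x - ftilde x| ≤ δ) (x : F) :
    Integrable (fun u => diffQuot ftilde μ x u * fderiv ℝ (gaussSmooth lam f μ) x u)
      (gaussMeasure lam) ∧
    3 / 4 * ‖fderiv ℝ (gaussSmooth lam f μ) x‖ ^ 2 - 4 * δ ^ 2 / μ ^ 2 * Module.finrank ℝ F ≤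
      ∫ u, diffQuot ftilde μ x u * fderiv ℝ (gaussSmooth lam f μ) x u ∂gaussMeasure lam := by
  set s := fderiv ℝ (gaussSmooth lam f μ) x with hs
  have hsP : PolyGrowth fun u => s u :=
    (polyGrowth_const s).of_le_mul polyGrowth_id fun u => s.le_opNorm u
  -- The kernel formula for $\nabla f_\mu(x)$, tested against the gradient itself; the $f(x)$ part
  -- of the quotient has mean zero.
  have hmain : ∫ u, diffQuot f μ x u * s u ∂gaussMeasure lam = ‖s‖ ^ 2 := by
    obtain ⟨v, hv⟩ := (InnerProductSpace.toDual ℝ F).surjective s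
    have hsv : ∀ u : F, s u = inner ℝ u v := fun u => by
      rw [← hv, InnerProductSpace.toDual_apply_apply, real_inner_comm]
    have h1 := hf.fderiv_gaussSmooth_apply lam hμ x v
    rw [← hs, hsv v, real_inner_self_eq_norm_sq] at h1
    have hin := (polyGrowth_inner_right v).integrable lam (by fun_prop)
    have hi : Integrable (fun u => f (x + μ • u) * inner ℝ u v) (gaussMeasure lam) :=
      ((hf.polyGrowth.comp_affine x μ).mul (polyGrowth_inner_right v)).integrable lam
        (((hf.differentiable.continuous.measurable.comp (by fun_prop)).mul
          (by fun_prop)).aestronglyMeasurable)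
    have h2 : ∀ u, diffQuot f μ x u * s u =
        1 / μ * (f (x + μ • u) * inner ℝ u v - f x * inner ℝ u v) := fun u => by
      rw [diffQuot, hsv]; ring
    simp only [h2]
    rw [integral_const_mul, integral_sub hi (hin.const_mul _), integral_const_mul,
      integral_inner_gaussMeasure, mul_zero, sub_zero, ← h1, ← hv, LinearIsometryEquiv.norm_map]
  have hi1 : Integrable (fun u => diffQuot f μ x u * s u) (gaussMeasure lam) :=
    ((polyGrowth_diffQuot hf.polyGrowth μ x).mul hsP).integrable lam
      ((measurable_diffQuot hf.differentiable.continuous.measurable μ x).mul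
        (by fun_prop)).aestronglyMeasurable
  have hi2 : Integrable (fun u => diffQuot ftilde μ x u * s u) (gaussMeasure lam) :=
    ((polyGrowth_diffQuot (polyGrowth_of_abs_sub_le hf.polyGrowth hft) μ x).mul hsP).integrable lam
      ((measurable_diffQuot hm μ x).mul (by fun_prop)).aestronglyMeasurable
  refine ⟨hi2, ?_⟩
  have hpt : ∀ u : F, diffQuot f μ x u * s u - (4 * δ ^ 2 / μ ^ 2 * ‖u‖ ^ 2 + ‖s‖ ^ 2 / 4) ≤
      diffQuot ftilde μ x u * s u := fun u => by
    have h1 := abs_diffQuot_le hμ hft x u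
    have h2 : |s u| ≤ ‖s‖ * ‖u‖ := s.le_opNorm u
    have h3 : |(diffQuot ftilde μ x u - diffQuot f μ x u) * s u| ≤
        2 * δ / μ * (‖s‖ * ‖u‖) := by
      rw [abs_mul]
      exact mul_le_mul h1 h2 (abs_nonneg _) ((abs_nonneg _).trans h1)
    -- Young's inequality $ab\le a^2+b^2/4$; the last term is what lowers the coefficient of
    -- $\|s\|^2$ to $3/4$.
    have h4 : 2 * δ / μ * (‖s‖ * ‖u‖) ≤ 4 * δ ^ 2 / μ ^ 2 * ‖u‖ ^ 2 + ‖s‖ ^ 2 / 4 := by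
      have h5 : 4 * δ ^ 2 / μ ^ 2 * ‖u‖ ^ 2 = (2 * δ / μ * ‖u‖) ^ 2 := by ring
      rw [h5]
      nlinarith [sq_nonneg (2 * δ / μ * ‖u‖ - ‖s‖ / 2)]
    have h6 := (abs_le.1 h3).1
    linarith
  have hi3 : Integrable (fun u : F => 4 * δ ^ 2 / μ ^ 2 * ‖u‖ ^ 2 + ‖s‖ ^ 2 / 4)
      (gaussMeasure lam) :=
    ((integrable_norm_pow_gaussMeasure lam 2).const_mul _).add (integrable_const _)
  have h := integral_mono (hi1.sub hi3) hi2 hpt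
  rw [integral_sub' hi1 hi3, hmain, integral_add
    ((integrable_norm_pow_gaussMeasure lam 2).const_mul _) (integrable_const _),
    integral_const_mul, integral_norm_sq_gaussMeasure] at h
  simp only [integral_const, probReal_univ, one_smul] at h
  linarith

/-- Expected decrease of the smoothing in one step of the method. -/
lemma integral_gaussSmooth_step_le (hf : HasHolderGradient f ν L) (hμ : 0 < μ)
    (hm : Measurable ftilde) (hft : ∀ x, |f x - ftilde x| ≤ δ) {A₁ A₂ A₁' A₂' : ℝ}
    (hA : IsSlackPair (Module.finrank ℝ F) ν L μ A₁ A₂)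
    (hA' : IsSlackPair (Module.finrank ℝ F) ν L μ A₁' A₂') (hA₁ : 0 < A₁)
    {D h : ℝ} (hD0 : 0 < D) (hD1 : D ≤ 1)
    (hh : h = D / (80 * ((Module.finrank ℝ F : ℝ) + 4) * A₁)) (x : F) :
    ∫ u, gaussSmooth lam f μ (x - h • diffQuot ftilde μ x u • u) ∂gaussMeasure lam ≤
      gaussSmooth lam f μ x - h / 4 * ‖fderiv ℝ (gaussSmooth lam f μ) x‖ ^ 2 +
        (h * (4 * δ ^ 2 / μ ^ 2 * Module.finrank ℝ F +
          D / (32 * ((Module.finrank ℝ F : ℝ) + 4)) *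
            residual (Module.finrank ℝ F) ν L μ δ A₁' A₂') + A₂) := by
  have h1 := integral_diffQuot_sq_mul_le lam hf hμ hm hft hA' x
  obtain ⟨hi2, h2⟩ := le_integral_diffQuot_mul_fderiv lam hf hμ hm hft x
  have hi1 := integrable_diffQuot_sq_mul lam hf hm hft x (μ := μ)
  have hX := residual_nonneg (Module.finrank ℝ F) (ν := ν) (L := L) (δ := δ) (A₁ := A₁')
    (A₂ := A₂') hμ
  set X := residual (Module.finrank ℝ F) ν L μ δ A₁' A₂'
  set s := fderiv ℝ (gaussSmooth lam f μ) x with hs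
  set n : ℝ := (Module.finrank ℝ F : ℝ) with hn
  have hn0 : 0 ≤ n := by positivity
  have hh0 : 0 < h := by rw [hh]; positivity
  have hpt : ∀ u : F, gaussSmooth lam f μ (x - h • diffQuot ftilde μ x u • u) ≤
      (gaussSmooth lam f μ x + A₂) - h * (diffQuot ftilde μ x u * s u) +
        A₁ / 2 * h ^ 2 * (diffQuot ftilde μ x u ^ 2 * ‖u‖ ^ 2) := fun u => by
    have h3 := (abs_le.1 (hA.abs_taylor_gaussSmooth_le lam hf hμ x
      (x - h • diffQuot ftilde μ x u • u))).2
    have h4 : x - h • diffQuot ftilde μ x u • u - x = -(h * diffQuot ftilde μ x u) • u := by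
      rw [sub_sub_cancel_left, smul_smul, neg_smul]
    rw [h4, map_smul, norm_smul, ← hs, smul_eq_mul, mul_pow, Real.norm_eq_abs, sq_abs] at h3
    nlinarith
  have hsm := hf.gaussSmooth lam hμ
  have hint : Integrable (fun u => gaussSmooth lam f μ (x - h • diffQuot ftilde μ x u • u))
      (gaussMeasure lam) := by
    refine (hsm.polyGrowth.comp ((polyGrowth_const x).sub ((polyGrowth_const h).smul
      ((polyGrowth_diffQuot (polyGrowth_of_abs_sub_le hf.polyGrowth hft) μ x).smul
        polyGrowth_id)))).integrable lam ?_
    refine (hsm.differentiable.continuous.measurable.comp ?_).aestronglyMeasurable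
    have := measurable_diffQuot hm μ x
    fun_prop
  have hiA : Integrable (fun u => (gaussSmooth lam f μ x + A₂) - h * (diffQuot ftilde μ x u * s u))
      (gaussMeasure lam) := (integrable_const _).sub (hi2.const_mul h)
  have h5 := integral_mono hint (hiA.add (hi1.const_mul (A₁ / 2 * h ^ 2))) hpt
  rw [integral_add' hiA (hi1.const_mul (A₁ / 2 * h ^ 2)), integral_sub (integrable_const _)
    (hi2.const_mul h), integral_const_mul, integral_const_mul] at h5
  simp only [integral_const, probReal_univ, one_smul] at h5
  have h6 := mul_le_mul_of_nonneg_left h1 (show 0 ≤ A₁ / 2 * h ^ 2 by positivity)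
  have h7 := mul_le_mul_of_nonneg_left h2 hh0.le
  -- The choice of $h$ gives $\frac52A_1h=\frac D{32(n+4)}$. With $D\le1$ the quadratic term costs
  -- at most $\frac h{32}\|s\|^2$, and $\frac34-\frac1{32}\ge\frac14$.
  have h8 : A₁ / 2 * h ^ 2 * (5 * ((n + 2) * ‖s‖ ^ 2 + X)) =
      h * (D / (32 * (n + 4)) * ((n + 2) * ‖s‖ ^ 2)) + h * (D / (32 * (n + 4)) * X) := by
    rw [hh]
    field_simp
    ring
  have h9 : D / (32 * (n + 4)) * ((n + 2) * ‖s‖ ^ 2) ≤ 1 / 32 * ‖s‖ ^ 2 := by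
    rw [← mul_assoc]
    gcongr
    rw [div_mul_eq_mul_div, div_le_div_iff₀ (by positivity) (by positivity)]
    nlinarith
  have h10 := mul_le_mul_of_nonneg_left h9 hh0.le
  have h11 : 0 ≤ h * ‖s‖ ^ 2 := by positivity
  linarith

end OneStep

/-! ### The random iterates: measurability, independence, square integrability and the convergence
rate. -/

section Iterates

variable {F : Type*} [NormedAddCommGroup F] [InnerProductSpace ℝ F] [FiniteDimensional ℝ F]
  [MeasurableSpace F] [BorelSpace F] (lam : Measure F) [lam.IsAddHaarMeasure]
  {f ftilde : F → ℝ} {ν L μ δ h : ℝ}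
  {Ω : Type*} [MeasurableSpace Ω] {P : Measure Ω} {N : ℕ} {v : Fin N → Ω → F} {y : ℕ → Ω → F}

lemma measurable_step (hm : Measurable ftilde) (μ h : ℝ) :
    Measurable fun p : F × F => p.1 - h • diffQuot ftilde μ p.1 p.2 • p.2 := by
  unfold diffQuot
  fun_prop

/-- The iterate at time `k` depends only on the directions drawn before time `k`. -/
lemma measurable_iterate_iSup_comap (hm : Measurable ftilde) {y₀ : F} (hy0 : ∀ ω, y 0 ω = y₀)
    (hy : ∀ (k : Fin N) (ω : Ω), y ((k : ℕ) + 1) ω =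
      y k ω - h • diffQuot ftilde μ (y k ω) (v k ω) • v k ω) (k : ℕ) (hk : k ≤ N) :
    Measurable[⨆ j ∈ {j : Fin N | (j : ℕ) < k}, MeasurableSpace.comap (v j) inferInstance]
      (y k) := by
  induction k with
  | zero =>
    rw [show y 0 = fun _ => y₀ from funext hy0]
    exact measurable_const
  | succ k ih =>
    have h1 := ih (by omega)
    set j : Fin N := ⟨k, hk⟩ with hj
    have h2 : y (k + 1) = fun ω => y k ω - h • diffQuot ftilde μ (y k ω) (v j ω) • v j ω :=
      funext fun ω => hy j ω
    rw [h2]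
    have h3 : Measurable[⨆ j ∈ {j : Fin N | (j : ℕ) < k + 1},
        MeasurableSpace.comap (v j) inferInstance] (y k) := by
      refine h1.mono (biSup_mono fun i (hi : (i : ℕ) < k) => ?_) le_rfl
      exact Nat.lt_succ_of_lt hi
    have h4 : Measurable[⨆ j ∈ {j : Fin N | (j : ℕ) < k + 1},
        MeasurableSpace.comap (v j) inferInstance] (v j) :=
      (comap_measurable (v j)).mono (le_biSup (fun j : Fin N =>
        MeasurableSpace.comap (v j) inferInstance)
        (show j ∈ {j : Fin N | (j : ℕ) < k + 1} by simp [hj])) le_rfl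
    exact (measurable_step hm μ h).comp (h3.prodMk h4)

lemma measurable_iterate (hm : Measurable ftilde) (hv : ∀ k, Measurable (v k)) {y₀ : F}
    (hy0 : ∀ ω, y 0 ω = y₀) (hy : ∀ (k : Fin N) (ω : Ω), y ((k : ℕ) + 1) ω =
      y k ω - h • diffQuot ftilde μ (y k ω) (v k ω) • v k ω) (k : ℕ) (hk : k ≤ N) :
    Measurable (y k) :=
  (measurable_iterate_iSup_comap hm hy0 hy k hk).mono
    (iSup₂_le fun j _ => (hv j).comap_le) le_rfl

lemma indepFun_iterate (hm : Measurable ftilde) (hv : ∀ k, Measurable (v k))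
    (hind : iIndepFun v P) {y₀ : F} (hy0 : ∀ ω, y 0 ω = y₀)
    (hy : ∀ (k : Fin N) (ω : Ω), y ((k : ℕ) + 1) ω =
      y k ω - h • diffQuot ftilde μ (y k ω) (v k ω) • v k ω) (k : Fin N) :
    IndepFun (y k) (v k) P := by
  have h1 := indep_iSup_of_disjoint (fun j => (hv j).comap_le) hind
    (S := {j : Fin N | (j : ℕ) < k}) (T := {k}) (by simp)
  rw [IndepFun_iff_Indep]
  refine indep_of_indep_of_le_left (indep_of_indep_of_le_right h1 ?_) ?_
  · simp
  · exact (measurable_iterate_iSup_comap hm hy0 hy k k.2.le).comap_le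

/-- The bound separates $x$ from $u$, so that for an independent pair the square of the step is
integrable as a product. -/
lemma abs_diffQuot_le_mul (hf : HasHolderGradient f ν L) (hμ : 0 < μ)
    (hft : ∀ x, |f x - ftilde x| ≤ δ) (x u : F) :
    |diffQuot ftilde μ x u| ≤ (1 + ‖x‖) *
      ((‖fderiv ℝ f 0‖ + L + L * (1 + μ * ‖u‖)) * ‖u‖ + 2 * δ / μ) := by
  have hL := hf.const_nonneg
  have hδ : 0 ≤ δ := (abs_nonneg _).trans (hft 0)
  have h1 := abs_diffQuot_le hμ hft x u
  have h2 := hf.abs_sub_le x (x + μ • u)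
  have h3 := hf.norm_fderiv_le x
  rw [add_sub_cancel_left, norm_smul, Real.norm_eq_abs, abs_of_pos hμ] at h2
  have h4 : |diffQuot f μ x u| ≤ (1 + ‖x‖) *
      ((‖fderiv ℝ f 0‖ + L + L * (1 + μ * ‖u‖)) * ‖u‖) := by
    rw [diffQuot, abs_div, abs_of_pos hμ, div_le_iff₀ hμ]
    refine h2.trans ?_
    rw [mul_assoc, mul_assoc, mul_comm ‖u‖ μ, ← mul_assoc (1 + ‖x‖)]
    gcongr
    have h5 : 0 ≤ ‖x‖ * ‖fderiv ℝ f 0‖ := by positivity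
    have h6 : 0 ≤ ‖x‖ * (L * (1 + μ * ‖u‖)) := by positivity
    nlinarith
  have h5 := abs_sub_abs_le_abs_sub (diffQuot ftilde μ x u) (diffQuot f μ x u)
  have h6 : 0 ≤ ‖x‖ * (2 * δ / μ) := by positivity
  linarith

/-- Second moments suffice for all expectations below: the gradient of the smoothing grows linearly
and the smoothing itself at most quadratically. -/
lemma memLp_two_iterate [IsProbabilityMeasure P] (hf : HasHolderGradient f ν L) (hμ : 0 < μ)
    (hft : ∀ x, |f x - ftilde x| ≤ δ) (hm : Measurable ftilde) (hv : ∀ k, Measurable (v k))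
    (hlaw : ∀ k, P.map (v k) = gaussMeasure lam)
    (hind : iIndepFun v P) {y₀ : F} (hy0 : ∀ ω, y 0 ω = y₀)
    (hy : ∀ (k : Fin N) (ω : Ω), y ((k : ℕ) + 1) ω =
      y k ω - h • diffQuot ftilde μ (y k ω) (v k ω) • v k ω) (k : ℕ) (hk : k ≤ N) :
    MemLp (y k) 2 P := by
  induction k with
  | zero =>
    rw [show y 0 = fun _ => y₀ from funext hy0]
    exact memLp_const _
  | succ k ih =>
    have h1 := ih (by omega)
    have hmk := measurable_iterate hm hv hy0 hy k (by omega)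
    set j : Fin N := ⟨k, hk⟩ with hj
    have h2 : y (k + 1) = fun ω => y k ω - h • diffQuot ftilde μ (y k ω) (v j ω) • v j ω :=
      funext fun ω => hy j ω
    set Q : F → ℝ := fun u => ((‖fderiv ℝ f 0‖ + L + L * (1 + μ * ‖u‖)) * ‖u‖ + 2 * δ / μ) * ‖u‖
      with hQ
    have hQm : Measurable Q := by fun_prop
    have hQg : PolyGrowth Q :=
      ((((polyGrowth_const _).add ((polyGrowth_const L).mul ((polyGrowth_const (1 : ℝ)).add
        ((polyGrowth_const μ).mul polyGrowth_norm)))).mul polyGrowth_norm).add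
        (polyGrowth_const _)).mul polyGrowth_norm
    have hQi : Integrable (fun ω => Q (v j ω) ^ 2) P := by
      have h3 := (hQg.pow 2).integrable lam (hQm.pow_const 2).aestronglyMeasurable
      rw [← hlaw j] at h3
      exact h3.comp_measurable (hv j)
    have hYi : Integrable (fun ω => (1 + ‖y k ω‖) ^ 2) P :=
      (MemLp.add (memLp_const (1 : ℝ)) h1.norm).integrable_sq
    have hindk : IndepFun (y k) (v j) P := indepFun_iterate hm hv hind hy0 hy j
    have hprod : Integrable (fun ω => (1 + ‖y k ω‖) ^ 2 * Q (v j ω) ^ 2) P :=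
      (hindk.comp (φ := fun x => (1 + ‖x‖) ^ 2) (ψ := fun u => Q u ^ 2) (by fun_prop)
        (by fun_prop)).integrable_mul hYi hQi
    have hgm : Measurable fun ω => diffQuot ftilde μ (y k ω) (v j ω) • v j ω := by
      have hvj := hv j
      unfold diffQuot
      fun_prop
    have hg : MemLp (fun ω => diffQuot ftilde μ (y k ω) (v j ω) • v j ω) 2 P := by
      rw [memLp_two_iff_integrable_sq_norm hgm.aestronglyMeasurable]
      refine hprod.mono' (hgm.norm.pow_const 2).aestronglyMeasurable (.of_forall fun ω => ?_)
      rw [Real.norm_eq_abs, abs_of_nonneg (by positivity), ← mul_pow, norm_smul, Real.norm_eq_abs]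
      have := abs_diffQuot_le_mul hf hμ hft (y k ω) (v j ω)
      have h5 := mul_le_mul_of_nonneg_right this (norm_nonneg (v j ω))
      rw [mul_assoc] at h5
      gcongr
    rw [h2]
    exact h1.sub (hg.const_smul h)

lemma memLp_two_affine_norm [IsFiniteMeasure P] {z : Ω → F} (hz : MemLp z 2 P) (a b : ℝ) :
    MemLp (fun ω => a + b * (1 + ‖z ω‖)) 2 P := by
  have h1 : MemLp (fun ω => 1 + ‖z ω‖) 2 P := (memLp_const (1 : ℝ)).add hz.norm
  have h2 : MemLp (fun ω => b * (1 + ‖z ω‖)) 2 P := h1.const_mul b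
  exact (memLp_const a).add h2

lemma HasHolderGradient.integrable_comp_of_memLp [IsFiniteMeasure P]
    (hf : HasHolderGradient f ν L) {z : Ω → F} (hz : MemLp z 2 P) :
    Integrable (fun ω => f (z ω)) P := by
  have h1 : Integrable (fun ω => (‖fderiv ℝ f 0‖ + L * (1 + ‖z ω‖)) * ‖z ω‖) P :=
    (memLp_two_affine_norm hz ‖fderiv ℝ f 0‖ L).integrable_mul hz.norm
  have h4 : Integrable (fun ω => |f 0| + (‖fderiv ℝ f 0‖ + L * (1 + ‖z ω‖)) * ‖z ω‖) P :=
    (integrable_const |f 0|).add h1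
  refine h4.mono' (hf.differentiable.continuous.comp_aestronglyMeasurable hz.1)
    (.of_forall fun ω => ?_)
  have h2 := hf.abs_sub_le 0 (z ω)
  rw [sub_zero] at h2
  have h3 := abs_sub_abs_le_abs_sub (f (z ω)) (f 0)
  rw [Real.norm_eq_abs]
  linarith

lemma HasHolderGradient.integrable_norm_fderiv_sq_of_memLp [IsFiniteMeasure P]
    (hf : HasHolderGradient f ν L) {z : Ω → F} (hz : MemLp z 2 P) :
    Integrable (fun ω => ‖fderiv ℝ f (z ω)‖ ^ 2) P := by
  have h1 := (memLp_two_affine_norm hz ‖fderiv ℝ f 0‖ L).integrable_sq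
  have h2 : AEStronglyMeasurable (fun ω => ‖fderiv ℝ f (z ω)‖ ^ 2) P :=
    (((measurable_fderiv ℝ f).norm.pow_const 2).comp_aemeasurable
      hz.1.aemeasurable).aestronglyMeasurable
  refine h1.mono' h2 (.of_forall fun ω => ?_)
  rw [Real.norm_eq_abs, abs_of_nonneg (by positivity)]
  have h3 := hf.norm_fderiv_le (z ω)
  gcongr

/-- Convergence of the zeroth-order method in a Euclidean space. -/
theorem inf_integral_norm_fderiv_gaussSmooth_sq_le [IsProbabilityMeasure P]
    (hf : HasHolderGradient f ν L) (hμ : 0 < μ)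
    (hm : Measurable ftilde) (hft : ∀ x, |f x - ftilde x| ≤ δ) {c : ℝ} (hc : ∀ x, c ≤ f x)
    {A₁ A₂ A₁' A₂' : ℝ}
    (hA : IsSlackPair (Module.finrank ℝ F) ν L μ A₁ A₂)
    (hA' : IsSlackPair (Module.finrank ℝ F) ν L μ A₁' A₂') (hA₁ : 0 < A₁)
    {D : ℝ} (hD0 : 0 < D) (hD1 : D ≤ 1)
    (hh : h = D / (80 * ((Module.finrank ℝ F : ℝ) + 4) * A₁)) (hN : 0 < N)
    (hv : ∀ k, Measurable (v k)) (hlaw : ∀ k, P.map (v k) = gaussMeasure lam)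
    (hind : iIndepFun v P) {y₀ : F} (hy0 : ∀ ω, y 0 ω = y₀)
    (hy : ∀ (k : Fin N) (ω : Ω), y ((k : ℕ) + 1) ω =
      y k ω - h • diffQuot ftilde μ (y k ω) (v k ω) • v k ω) :
    (∀ k < N, Integrable (fun ω => ‖fderiv ℝ (gaussSmooth lam f μ) (y k ω)‖ ^ 2) P) ∧
    (Finset.range N).inf' (Finset.nonempty_range_iff.mpr hN.ne') (fun k =>
        ∫ ω, ‖fderiv ℝ (gaussSmooth lam f μ) (y k ω)‖ ^ 2 ∂P) ≤
      320 * ((Module.finrank ℝ F : ℝ) + 4) * A₁ * (gaussSmooth lam f μ y₀ - c) / (N * D)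
      + D / (4 * ((Module.finrank ℝ F : ℝ) + 4)) *
        residual (Module.finrank ℝ F) ν L μ δ A₁' A₂'
      + 320 * ((Module.finrank ℝ F : ℝ) + 4) * A₁ / D *
        (A₂ + δ ^ 2 / (2 * A₁ * μ ^ 2) * (Module.finrank ℝ F : ℝ) +
          δ ^ 2 / μ ^ 2 * (Module.finrank ℝ F : ℝ)) := by
  have hsm := hf.gaussSmooth lam hμ
  have hL2 := memLp_two_iterate lam hf hμ hft hm hv hlaw hind hy0 hy
  have hGi : ∀ k < N, Integrable (fun ω => ‖fderiv ℝ (gaussSmooth lam f μ) (y k ω)‖ ^ 2) P :=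
    fun k hk => hsm.integrable_norm_fderiv_sq_of_memLp (hL2 k hk.le)
  refine ⟨hGi, ?_⟩
  have hX := residual_nonneg (Module.finrank ℝ F) (ν := ν) (L := L) (δ := δ) (A₁ := A₁')
    (A₂ := A₂') hμ
  set R : ℝ := h * (4 * δ ^ 2 / μ ^ 2 * Module.finrank ℝ F +
    D / (32 * ((Module.finrank ℝ F : ℝ) + 4)) *
      residual (Module.finrank ℝ F) ν L μ δ A₁' A₂') + A₂ with hR
  set X := residual (Module.finrank ℝ F) ν L μ δ A₁' A₂'
  set n : ℝ := (Module.finrank ℝ F : ℝ) with hn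
  have hn0 : 0 ≤ n := by positivity
  set G : ℕ → ℝ := fun k => ∫ ω, ‖fderiv ℝ (gaussSmooth lam f μ) (y k ω)‖ ^ 2 ∂P with hG
  set φ : ℕ → ℝ := fun k => ∫ ω, gaussSmooth lam f μ (y k ω) ∂P with hφ
  have hstep : ∀ k < N, φ (k + 1) ≤ φ k - h / 4 * G k + R := by
    intro k hk
    set j : Fin N := ⟨k, hk⟩ with hj
    have hmk : Measurable (y k) := measurable_iterate hm hv hy0 hy k hk.le
    -- With a product law, Fubini plays the role of conditioning on the past: the one-step estimate
    -- applies to the inner integral at each fixed $x$.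
    have hlawk : P.map (fun ω => (y k ω, v j ω)) = (P.map (y k)).prod (gaussMeasure lam) := by
      have h1 : IndepFun (y k) (v j) P := indepFun_iterate hm hv hind hy0 hy j
      rw [← hlaw j]
      exact (indepFun_iff_map_prod_eq_prod_map_map hmk.aemeasurable (hv j).aemeasurable).1 h1
    have : IsProbabilityMeasure (P.map (y k)) := Measure.isProbabilityMeasure_map hmk.aemeasurable
    have hpm : Measurable fun ω => (y k ω, v j ω) := hmk.prodMk (hv j)
    set H : F × F → ℝ :=
      fun p => gaussSmooth lam f μ (p.1 - h • diffQuot ftilde μ p.1 p.2 • p.2) with hH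
    have hHm : Measurable H := hsm.differentiable.continuous.measurable.comp (measurable_step hm μ h)
    have hyk : ∀ ω, gaussSmooth lam f μ (y (k + 1) ω) = H (y k ω, v j ω) := fun ω => by
      exact congrArg (gaussSmooth lam f μ) (hy j ω)
    have hHi : Integrable H ((P.map (y k)).prod (gaussMeasure lam)) := by
      rw [← hlawk, integrable_map_measure hHm.aestronglyMeasurable hpm.aemeasurable]
      refine (hsm.integrable_comp_of_memLp (hL2 (k + 1) hk)).congr (.of_forall fun ω => ?_)
      exact hyk ω
    have hφ1 : φ (k + 1) = ∫ x, ∫ u, H (x, u) ∂gaussMeasure lam ∂(P.map (y k)) := by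
      rw [← integral_prod _ hHi, ← hlawk, integral_map hpm.aemeasurable hHm.aestronglyMeasurable]
      exact integral_congr_ae (.of_forall hyk)
    have hmS : Measurable (gaussSmooth lam f μ) := hsm.differentiable.continuous.measurable
    have hmG : Measurable fun x => ‖fderiv ℝ (gaussSmooth lam f μ) x‖ ^ 2 :=
      (measurable_fderiv ℝ _).norm.pow_const 2
    have hSi : Integrable (gaussSmooth lam f μ) (P.map (y k)) :=
      (integrable_map_measure hmS.aestronglyMeasurable hmk.aemeasurable).2
        (hsm.integrable_comp_of_memLp (hL2 k hk.le))
    have hGi' : Integrable (fun x => ‖fderiv ℝ (gaussSmooth lam f μ) x‖ ^ 2) (P.map (y k)) :=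
      (integrable_map_measure hmG.aestronglyMeasurable hmk.aemeasurable).2 (hGi k hk)
    have hSG : Integrable (fun x => gaussSmooth lam f μ x -
        h / 4 * ‖fderiv ℝ (gaussSmooth lam f μ) x‖ ^ 2) (P.map (y k)) :=
      hSi.sub (hGi'.const_mul _)
    have hle := integral_mono hHi.integral_prod_left (hSG.add (integrable_const R)) fun x =>
      integral_gaussSmooth_step_le lam hf hμ hm hft hA hA' hA₁ hD0 hD1 hh x
    rw [← hφ1, integral_add' hSG (integrable_const R), integral_sub hSi (hGi'.const_mul _),
      integral_const_mul, integral_map hmk.aemeasurable hmS.aestronglyMeasurable,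
      integral_map hmk.aemeasurable hmG.aestronglyMeasurable] at hle
    simpa using hle
  have hsum : ∀ k ≤ N, φ k + h / 4 * ∑ i ∈ Finset.range k, G i ≤ φ 0 + k * R := by
    intro k hk
    induction k with
    | zero => simp
    | succ k ih =>
      have h1 := ih (by omega)
      have h2 := hstep k hk
      rw [Finset.sum_range_succ]
      push_cast
      linarith
  have hφ0 : φ 0 = gaussSmooth lam f μ y₀ := by simp [hφ, hy0]
  have hφN : c ≤ φ N := by
    have := integral_mono (μ := P) (integrable_const c)
      (hsm.integrable_comp_of_memLp (hL2 N le_rfl)) fun ω => le_gaussSmooth lam hf hc (y N ω)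
    simpa using this
  set m := (Finset.range N).inf' (Finset.nonempty_range_iff.mpr hN.ne') G with hmdef
  have hmle : N * m ≤ ∑ i ∈ Finset.range N, G i := by
    have := Finset.card_nsmul_le_sum (Finset.range N) G m fun i hi => Finset.inf'_le G hi
    simpa using this
  have hh0 : 0 < h := by rw [hh]; positivity
  have hN0 : (0 : ℝ) < N := Nat.cast_pos.2 hN
  have h1 := hsum N le_rfl
  have h2 : h / 4 * (N * m) ≤ gaussSmooth lam f μ y₀ - c + N * R := by
    have := mul_le_mul_of_nonneg_left hmle (show 0 ≤ h / 4 by positivity)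
    linarith
  have h3 : m ≤ (gaussSmooth lam f μ y₀ - c + N * R) / (h / 4 * N) := by
    rw [le_div_iff₀ (by positivity)]
    linarith
  refine h3.trans ?_
  -- Here $4/h=320(n+4)A_1/D$. What this yields is sharper than the claim: the residual coefficient
  -- is doubled, $16\delta^2n/\mu^2$ is absorbed in the term with $2A_1\mu^2$, and the last
  -- $\delta^2$ term is added as a nonnegative quantity.
  have h4 : (gaussSmooth lam f μ y₀ - c + N * R) / (h / 4 * N) =
      320 * (n + 4) * A₁ * (gaussSmooth lam f μ y₀ - c) / (N * D) + D / (8 * (n + 4)) * X +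
        320 * (n + 4) * A₁ / D * A₂ + 16 * (δ ^ 2 / μ ^ 2 * n) := by
    rw [hR, hh]
    field_simp
    ring
  have h5 : D / (8 * (n + 4)) * X ≤ D / (4 * (n + 4)) * X := by
    gcongr
    norm_num
  have h6 : 320 * (n + 4) * A₁ / D * (δ ^ 2 / (2 * A₁ * μ ^ 2) * n) =
      160 * ((n + 4) / D) * (δ ^ 2 / μ ^ 2 * n) := by
    field_simp
    ring
  have h7 : 1 ≤ (n + 4) / D := by
    rw [le_div_iff₀ hD0]
    linarith
  have h8 : 0 ≤ δ ^ 2 / μ ^ 2 * n := by positivity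
  have h9 : 16 * (δ ^ 2 / μ ^ 2 * n) ≤ 160 * ((n + 4) / D) * (δ ^ 2 / μ ^ 2 * n) := by
    gcongr
    linarith
  have h10 : 0 ≤ 320 * (n + 4) * A₁ / D * (δ ^ 2 / μ ^ 2 * n) := by positivity
  have h11 : 320 * (n + 4) * A₁ / D * (A₂ + δ ^ 2 / (2 * A₁ * μ ^ 2) * n + δ ^ 2 / μ ^ 2 * n) =
      320 * (n + 4) * A₁ / D * A₂ + 160 * ((n + 4) / D) * (δ ^ 2 / μ ^ 2 * n) +
        320 * (n + 4) * A₁ / D * (δ ^ 2 / μ ^ 2 * n) := by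
    rw [← h6]
    ring
  rw [h4, h11]
  linarith

end Iterates

/-! ### Transfer between $(E,B)$ and the standard Euclidean space. -/

/-- A Euclidean structure given by a bilinear form is isometric to the standard one. -/
lemma exists_linearEquiv_euclideanSpace {E : Type*} [AddCommGroup E] [Module ℝ E]
    [FiniteDimensional ℝ E] {n : ℕ} (hn : Module.finrank ℝ E = n) (b : E →ₗ[ℝ] E →ₗ[ℝ] ℝ)
    (hsymm : ∀ x y, b x y = b y x) (hpos : ∀ x, x ≠ 0 → 0 < b x x) :
    ∃ T : E ≃ₗ[ℝ] EuclideanSpace ℝ (Fin n), ∀ x y, inner ℝ (T x) (T y) = b x y := by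
  let core : InnerProductSpace.Core ℝ E :=
    { inner := fun x y => b x y
      conj_inner_symm := fun x y => by simpa using hsymm y x
      re_inner_nonneg := fun x => by
        rcases eq_or_ne x 0 with rfl | hx
        · simp
        · simpa using (hpos x hx).le
      add_left := fun x y z => by simp
      smul_left := fun x y r => by simp
      definite := fun x hx => by
        by_contra h
        exact (hpos x h).ne' hx }
  -- This norm stays local: only a linear map leaves the proof, and its continuity for the given
  -- norm comes from finite dimension.
  let _ : NormedAddCommGroup E := core.toNormedAddCommGroup
  let _ : InnerProductSpace ℝ E := InnerProductSpace.ofCore core.toCore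
  let e := (stdOrthonormalBasis ℝ E).reindex (finCongr hn)
  exact ⟨e.repr.toLinearEquiv, fun x y => e.repr.inner_map_map x y⟩

section Transfer

variable {E : Type*} [NormedAddCommGroup E] [NormedSpace ℝ E]
  {F : Type*} [NormedAddCommGroup F] [InnerProductSpace ℝ F]
  {B : E ≃L[ℝ] StrongDual ℝ E} {T : E ≃L[ℝ] F}

lemma primalNorm_eq_norm (hT : ∀ x y, inner ℝ (T x) (T y) = B x y) (x : E) :
    primalNorm B x = ‖T x‖ := by
  rw [primalNorm, ← hT, real_inner_self_eq_norm_sq, Real.sqrt_sq (norm_nonneg _)]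

lemma gaussWeight_eq_exp (hT : ∀ x y, inner ℝ (T x) (T y) = B x y) (x : E) :
    gaussWeight B x = Real.exp (-(1 / 2) * ‖T x‖ ^ 2) := by
  rw [gaussWeight, primalNorm_eq_norm hT]

/-- If $w$ is the Riesz vector of $s\circ T^{-1}$, then $B^{-1}s=T^{-1}w$, so $\langle
s,B^{-1}s\rangle=\|w\|^2$. -/
lemma dualNorm_eq_norm [CompleteSpace F] (hT : ∀ x y, inner ℝ (T x) (T y) = B x y)
    (s : StrongDual ℝ E) :
    dualNorm B s = ‖s.comp (T.symm : F →L[ℝ] E)‖ := by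
  obtain ⟨w, hw⟩ := (InnerProductSpace.toDual ℝ F).surjective (s.comp (T.symm : F →L[ℝ] E))
  have hs : ∀ x, s x = inner ℝ w (T x) := fun x => by
    have := congrArg (fun l : StrongDual ℝ F => l (T x)) hw
    simpa using this.symm
  have hB : B.symm s = T.symm w := by
    rw [ContinuousLinearEquiv.symm_apply_eq]
    ext x
    rw [hs, ← hT, T.apply_symm_apply]
  rw [dualNorm, hB, hs, T.apply_symm_apply, ← hw, LinearIsometryEquiv.norm_map,
    real_inner_self_eq_norm_sq, Real.sqrt_sq (norm_nonneg _)]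

lemma HasHolderGradient.of_dualNorm [CompleteSpace F]
    (hT : ∀ x y, inner ℝ (T x) (T y) = B x y) {f : E → ℝ} {ν L : ℝ}
    (hν0 : 0 ≤ ν) (hν1 : ν ≤ 1) (hL : 0 ≤ L) (hf : Differentiable ℝ f)
    (hHolder : ∀ x y : E, dualNorm B (fderiv ℝ f y - fderiv ℝ f x) ≤
      L * primalNorm B (y - x) ^ ν) :
    HasHolderGradient (f ∘ T.symm) ν L := by
  refine ⟨hf.comp T.symm.differentiable, fun x y => ?_, hν0, hν1, hL⟩
  have h := hHolder (T.symm x) (T.symm y)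
  rw [dualNorm_eq_norm hT, primalNorm_eq_norm hT, map_sub, T.apply_symm_apply,
    T.apply_symm_apply, ContinuousLinearMap.sub_comp] at h
  rwa [T.symm.comp_right_fderiv, T.symm.comp_right_fderiv]

variable [FiniteDimensional ℝ E] [MeasurableSpace E] [BorelSpace E] [FiniteDimensional ℝ F]
  [MeasurableSpace F] [BorelSpace F]

lemma integral_map_addHaar {G : Type*} [NormedAddCommGroup G] [NormedSpace ℝ G] (g : F → G) :
    ∫ z, g z ∂((Measure.addHaar : Measure E).map T) = ∫ u : E, g (T u) ∂Measure.addHaar :=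
  T.toHomeomorph.measurableEmbedding.integral_map g

lemma kappa_eq (hT : ∀ x y, inner ℝ (T x) (T y) = B x y) :
    kappa B = ∫ z, Real.exp (-(1 / 2) * ‖z‖ ^ 2) ∂((Measure.addHaar : Measure E).map T) := by
  rw [kappa, integral_map_addHaar]
  simp only [gaussWeight_eq_exp hT]

/-- The target carries the pushforward of the Haar measure of $E$, so no Jacobian appears. -/
lemma smoothed_eq (hT : ∀ x y, inner ℝ (T x) (T y) = B x y) (f : E → ℝ) (μ : ℝ) :
    smoothed B f μ = gaussSmooth ((Measure.addHaar : Measure E).map T) (f ∘ T.symm) μ ∘ T := by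
  have : ((Measure.addHaar : Measure E).map T).IsAddHaarMeasure := T.isAddHaarMeasure_map _
  funext x
  rw [Function.comp_apply, gaussSmooth, integral_gaussMeasure, smoothed, kappa_eq hT, smul_eq_mul]
  congr 1
  rw [integral_map_addHaar]
  refine integral_congr_ae (.of_forall fun u => ?_)
  simp only [Function.comp_apply, map_add, map_smul, T.symm_apply_apply, gaussWeight_eq_exp hT,
    smul_eq_mul]
  ring

lemma map_stdGaussianLaw (hT : ∀ x y, inner ℝ (T x) (T y) = B x y) :
    (stdGaussianLaw B).map T = gaussMeasure ((Measure.addHaar : Measure E).map T) := by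
  have hTm : Measurable T := T.continuous.measurable
  ext s hs
  rw [Measure.map_apply hTm hs, stdGaussianLaw, gaussMeasure, withDensity_apply _ (hTm hs),
    withDensity_apply _ hs, setLIntegral_map hs (by fun_prop) hTm]
  simp only [gaussWeight_eq_exp hT, kappa_eq hT]

lemma dualNorm_fderiv_smoothed (hT : ∀ x y, inner ℝ (T x) (T y) = B x y) (f : E → ℝ) (μ : ℝ)
    (x : E) : dualNorm B (fderiv ℝ (smoothed B f μ) x) =
      ‖fderiv ℝ (gaussSmooth ((Measure.addHaar : Measure E).map T) (f ∘ T.symm) μ) (T x)‖ := by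
  rw [smoothed_eq hT, T.comp_right_fderiv, dualNorm_eq_norm hT]
  congr 1
  ext z
  simp

end Transfer

end ZerothOrder

/-! ### The theorem, deduced from its Euclidean version. -/

theorem lemma3p1
    {E : Type*} [NormedAddCommGroup E] [NormedSpace ℝ E] [FiniteDimensional ℝ E]
    [MeasurableSpace E] [BorelSpace E]
    (n : ℕ) (hn : Module.finrank ℝ E = n)
    -- the Euclidean structure
    (B : E ≃L[ℝ] StrongDual ℝ E)
    (hBsymm : ∀ x y : E, B x y = B y x) (hBpos : ∀ x : E, x ≠ 0 → 0 < B x x)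
    -- the objective: differentiable with Hölder continuous gradient, with finite optimal value
    (f : E → ℝ) (ν L : ℝ) (hν0 : 0 ≤ ν) (hν1 : ν ≤ 1) (hL : 0 ≤ L)
    (hf : Differentiable ℝ f)
    (hHolder : ∀ x y : E, ZerothOrder.dualNorm B (fderiv ℝ f y - fderiv ℝ f x) ≤
      L * ZerothOrder.primalNorm B (y - x) ^ ν)
    (fstar : ℝ) (hfstar : IsGLB (Set.range f) fstar)
    -- the inexact zeroth-order oracle
    (δ : ℝ) (hδ : 0 ≤ δ) (ftilde : E → ℝ) (hft_meas : Measurable ftilde)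
    (hft : ∀ x : E, |f x - ftilde x| ≤ δ)
    -- the parameters
    (μ : ℝ) (hμ : 0 < μ) (D : ℝ) (hD0 : 0 < D) (hD1 : D ≤ 1)
    (A₁ A₂ A₁' A₂' : ℝ)
    (hA : ZerothOrder.IsSlackPair n ν L μ A₁ A₂)
    (hA' : ZerothOrder.IsSlackPair n ν L μ A₁' A₂')
    (hA₁ : 0 < A₁)
    (h : ℝ) (hh : h = D / (80 * ((n : ℝ) + 4) * A₁))
    -- the random directions and the process
    {Ω : Type*} [MeasurableSpace Ω] (P : Measure Ω) [IsProbabilityMeasure P]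
    (N : ℕ) (hN : 0 < N) (u : Fin N → Ω → E)
    (hu_meas : ∀ k, Measurable (u k))
    (hu_law : ∀ k, P.map (u k) = ZerothOrder.stdGaussianLaw B)
    (hu_indep : iIndepFun u P)
    (x₀ : E) (x : ℕ → Ω → E) (hx_zero : ∀ ω, x 0 ω = x₀)
    (hx_succ : ∀ (k : Fin N) (ω : Ω), x ((k : ℕ) + 1) ω =
      x k ω - h • B.symm (ZerothOrder.gradEst B ftilde μ (x k ω) (u k ω))) :
    -- `f_μ` is well defined and differentiable, and the expectations are finite
    (∀ y : E, Integrable (fun v => f (y + μ • v) * ZerothOrder.gaussWeight B v)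
      Measure.addHaar) ∧
    Differentiable ℝ (ZerothOrder.smoothed B f μ) ∧
    (∀ k : ℕ, k < N → Integrable (fun ω =>
      ZerothOrder.dualNorm B (fderiv ℝ (ZerothOrder.smoothed B f μ) (x k ω)) ^ 2) P) ∧
    -- the bound
    (Finset.range N).inf' (Finset.nonempty_range_iff.mpr hN.ne') (fun k =>
        ∫ ω, ZerothOrder.dualNorm B (fderiv ℝ (ZerothOrder.smoothed B f μ) (x k ω)) ^ 2 ∂P) ≤
      320 * ((n : ℝ) + 4) * A₁ * (ZerothOrder.smoothed B f μ x₀ - fstar) / (N * D)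
      + D / (4 * ((n : ℝ) + 4)) *
        (4 * δ ^ 2 / μ ^ 2 * n
          + 4 * L ^ 2 / (1 + ν) ^ 2 * μ ^ (2 * ν) * (n : ℝ) ^ (2 + ν)
          + μ ^ 2 * A₁' ^ 2 / 4 * ((n : ℝ) + 6) ^ 3
          + A₂' ^ 2 / μ ^ 2 * n)
      + 320 * ((n : ℝ) + 4) * A₁ / D *
        (A₂ + δ ^ 2 / (2 * A₁ * μ ^ 2) * n + δ ^ 2 / μ ^ 2 * n) := by
  subst hn
  obtain ⟨T₀, hT₀⟩ := ZerothOrder.exists_linearEquiv_euclideanSpace (n := Module.finrank ℝ E) rfl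
    (ContinuousLinearMap.coeLM ℝ ∘ₗ (B : E →L[ℝ] StrongDual ℝ E).toLinearMap) hBsymm hBpos
  set T : E ≃L[ℝ] EuclideanSpace ℝ (Fin (Module.finrank ℝ E)) := T₀.toContinuousLinearEquiv
  have hT : ∀ x y, inner ℝ (T x) (T y) = B x y := hT₀
  set lam := (Measure.addHaar : Measure E).map T with hlam
  have hhaar : lam.IsAddHaarMeasure := T.isAddHaarMeasure_map _
  have hg := ZerothOrder.HasHolderGradient.of_dualNorm hT hν0 hν1 hL hf hHolder
  have hTm : Measurable T := T.continuous.measurable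
  have hF : Module.finrank ℝ (EuclideanSpace ℝ (Fin (Module.finrank ℝ E))) =
    Module.finrank ℝ E := finrank_euclideanSpace_fin
  have hsm : ZerothOrder.smoothed B f μ = ZerothOrder.gaussSmooth lam (f ∘ T.symm) μ ∘ T :=
    ZerothOrder.smoothed_eq hT f μ
  have hnorm : ∀ y, ZerothOrder.dualNorm B (fderiv ℝ (ZerothOrder.smoothed B f μ) y) =
      ‖fderiv ℝ (ZerothOrder.gaussSmooth lam (f ∘ T.symm) μ) (T y)‖ :=
    ZerothOrder.dualNorm_fderiv_smoothed hT f μ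
  obtain ⟨h1, h2⟩ := ZerothOrder.inf_integral_norm_fderiv_gaussSmooth_sq_le lam hg hμ
    (ftilde := ftilde ∘ T.symm) (h := h) (hft_meas.comp T.symm.continuous.measurable)
    (fun z => hft (T.symm z)) (c := fstar) (fun z => hfstar.1 ⟨T.symm z, rfl⟩)
    (by rwa [hF]) (by rwa [hF]) hA₁ hD0 hD1 (by rwa [hF]) hN
    (v := fun k ω => T (u k ω)) (fun k => hTm.comp (hu_meas k))
    (fun k => by
      rw [← ZerothOrder.map_stdGaussianLaw hT, ← hu_law k, Measure.map_map hTm (hu_meas k)]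
      rfl)
    (hu_indep.comp (fun _ => T) fun _ => hTm) (y := fun k ω => T (x k ω)) (y₀ := T x₀)
    (fun ω => by rw [hx_zero])
    -- $B^{-1}$ cancels the $B$ in the gradient estimate, so the transported step is along the image
    -- of $u_k$.
    (fun k ω => by
      simp only [hx_succ k ω, ZerothOrder.gradEst, ZerothOrder.diffQuot, Function.comp_apply,
        map_sub, map_add, map_smul, T.symm_apply_apply, B.symm_apply_apply])
  rw [hF] at h2
  simp only [← hnorm] at h1 h2
  refine ⟨fun y => ?_, ?_, h1, ?_⟩
  · have h3 := (ZerothOrder.integrable_gaussMeasure_iff lam _).1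
      (hg.integrable_comp_affine lam (T y) (μ := μ))
    rw [hlam] at h3
    refine (h3.comp_measurable hTm).congr (.of_forall fun v => ?_)
    simp [ZerothOrder.gaussWeight_eq_exp hT, mul_comm]
  · rw [hsm]
    exact (hg.gaussSmooth lam hμ).differentiable.comp T.differentiable
  · rw [show ZerothOrder.smoothed B f μ x₀ = ZerothOrder.gaussSmooth lam (f ∘ T.symm) μ (T x₀) from
      congrFun hsm x₀]
    exact h2
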